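/- Let $R$ be a linearly ordered field, for instance a field of nonstandard real numbers, and let $m,n\in\mathbb N$. All operations on subsets are Minkowski operations. **Definitions.** A *neutrix* in $R$ or $R^n$ is a convex additive subgroup. An *external number* is a set $\alpha=a+N(\alpha)$ with $a\in R$ and $N(\alpha)=\alpha-\alpha\subseteq R$ a neutrix, its neutrix part; $\alpha$ is *neutricial* if $\alpha=N(\alpha)$. An *external point* is a set $\xi=x+N(\xi)\subseteq R^n$ with $N(\xi)=\xi-\xi$ a neutrix. The *linear part* $\xi_{(L)}$ is the union of all linear subspaces contained in $N(\xi)$; a *modular part* of $\xi$ is a neutrix $M$ with $N(\xi)=\xi_{(L)}\oplus M$. The dimension of a neutrix is the maximal cardinality of a linearly independent subset of it. For an $m\times n$ matrix $\mathcal A=(\alpha_{ij})$ and a vector $\mathcal B=(\beta_i)$ of external numbers, with $A_{ij}=N(\alpha_{ij})$, $B_i=N(\beta_i)$, the *solution* of $\mathcal Ax\subseteq\mathcal B$ is the set $\xi$ of all $x\in R^n$ with $\sum_j\alpha_{ij}x_j\subseteq\beta_i$ for all $i$. The system is *consistent* if $\xi\ne\emptyset$, and $\xi$ is *exact* if $\mathcal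 A\xi=\mathcal B$, with $\mathcal B$ identified with $\beta_1\times\cdots\times\beta_m$. A *representative matrix* of $\mathcal A$ is a matrix $P=(a_{ij})$ over $R$ with $a_{ij}\in\alpha_{ij}$. For a permutation matrix $H$, two systems are *$H$-equivalent* if $x$ solves the first one iff $y=Hx$ solves the second one. Let $F_j=\min_i\{c\in R\mid cA_{ij}\subseteq B_i\}$, and let $j_1<\dots<j_k$ be the indices $j$ with $F_j\neq R$. Let $\mathcal F^{(c)}=(F_{j_1},\dots,F_{j_k})^T$ and let $K$ be the $k\times n$ matrix whose $h$-th row is the unit row vector $e_{j_h}^T$. The *integrated system* associated by $P$ is $\begin{pmatrix}P\\K\end{pmatrix}x\in\begin{pmatrix}\mathcal B\\\mathcal F^{(c)}\end{pmatrix}$. A system $Qy\in\mathcal C$, with $Q=(q_{ij})$ a matrix over $R$ of rank $r\ge1$ and $\gamma_i=c_i+C_i$ the components of $\mathcal C$ ($c_i\in\gamma_i$, $C_i=N(\gamma_i)$), is *in increasing row-echelon form* if $Q$ is in row-echelon form, $q_{ii}=1$ iff $i\le r$, $|q_{ij}|\le1$ for all $i,j$, and $C_1\subseteq\dots\subseteq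 C_r$. It is *associated to $\mathcal Ax\subseteq\mathcal B$ by $P$* (with permutation matrix $H$) if it is in this form, is obtained from the integrated system associated by $P$ by Gaussian elimination (elementary row operations on both sides, and column interchanges recorded by $H$), and is $H$-equivalent to that integrated system. Write $Q^{(r)}$ for the block of the first $r$ rows and columns of $Q$, and $q^r_l$, $c^r$ for the first $r$ entries of the $l$-th column of $Q$ and of $c$; $e_i^r$, $e^{n-r}_{l-r}$ are canonical unit vectors of $R^r$, $R^{n-r}$. **Theorem.** Let $\mathcal Ax\subseteq\mathcal B$ be such a system with $B_i\ne R$ for all $i$, let $P$ be a representative matrix of $\mathcal A$, and assume that $r:=\operatorname{rank}\begin{pmatrix}P\\K\end{pmatrix}\ge1$. 1. There are a permutation matrix $H$ and a system $Qy\in\mathcal C$ in increasing row-echelon form, with $m+k$ rows, associated to $\mathcal Ax\subseteq\mathcal B$ by $P$ with $H$. Every such system has $\operatorname{rank}Q=r$ and is $H$-equivalent to $\mathcal Ax\subseteq\mathcal B$, and satisfies 2–5. 2. $Qy\in\mathcal C$ (equivalently, $\mathcal Ax\subseteq\mathcal B$) is consistent iff $\gamma_i$ is neutricial for $r+1\le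 i\le m+k$. In what follows assume consistency. 3. The solution $\zeta$ of $Qy\in\mathcal C$ is an external point, and it is also the solution of the system formed by the first $r$ rows of $Qy\in\mathcal C$, for which it is exact; it is exact for $Qy\in\mathcal C$ itself iff $\gamma_i=\{0\}$ for all $i>r$. For every choice of representatives $c_i\in\gamma_i$, $$\zeta=\begin{pmatrix}(Q^{(r)})^{-1}c^r\\0\end{pmatrix}+\sum_{i=1}^rC_i\begin{pmatrix}(Q^{(r)})^{-1}e_i^r\\0\end{pmatrix}+\sum_{l=r+1}^nR\begin{pmatrix}-(Q^{(r)})^{-1}q^r_l\\e^{n-r}_{l-r}\end{pmatrix}.$$ Here $Q^{(r)}$ is invertible and $(Q^{(r)})^{-1}$ is upper triangular. The solution of $\mathcal Ax\subseteq\mathcal B$ is $\xi=H^{-1}\zeta$. 4. The linear part $\zeta_{(L)}$ is the last of the three terms in this formula, and has dimension $n-r$. 5. The middle term is a modular part of $\zeta$, and its dimension is the number of nonzero neutrices among $C_1,\dots,C_r$. 6. $\operatorname{rank}\begin{pmatrix}P\\K\end{pmatrix}$, $\operatorname{rank}Q$, the neutrix part and the linear part of the solution $\xi=H^{-1}\zeta$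 (hence the images under $H^{-1}$ of the sum of the last two terms, and of the last term, of the formula), and the number of nonzero neutrices among $C_1,\dots,C_r$ do not depend on the choice of $P$ (nor of $H,Q,\mathcal C$). Every modular part of $\xi$ has dimension equal to this number. -/

import Mathlib

open scoped Pointwise

/-! Throughout, `R` is a linearly ordered field. The case of interest is a field of nonstandard
real numbers (for instance `Hyperreal`); the notions below only involve its structure of ordered
field, and arbitrary ("external") subsets of it. The numbers `m`, `n` of rows and columns are
elements of `ℕ`, i.e. standard. Algebraic operations on sets are the Minkowski operations. -/

section Neutrices

variable (R : Type*) [Field R] [LinearOrder R] {V : Type*} [AddCommGroup V] [Module R V]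

/-- A neutrix is a convex additive subgroup (of `V = R` or of `V = R ^ n`). -/
def IsNeutrix (N : Set V) : Prop :=
  (∃ G : AddSubgroup V, (G : Set V) = N) ∧ Convex R N

/-- An external point is the Minkowski sum of a point and a neutrix. -/
def IsExternalPoint (ξ : Set V) : Prop :=
  ∃ (p : V) (N : Set V), IsNeutrix R N ∧ ξ = {p} + N

/-- The neutrix part `{x' - x | x, x' ∈ ξ}` of an external point `ξ`. -/
def neutrixPart {V : Type*} [AddCommGroup V] (ξ : Set V) : Set V := ξ - ξ

/-- The union of all linear subspaces contained in the neutrix part of `ξ`. -/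
def linearPart (ξ : Set V) : Set V :=
  {x | ∃ S : Submodule R V, (S : Set V) ⊆ neutrixPart ξ ∧ x ∈ S}

/-- A modular part of `ξ` is a neutrix `M` that is a complement of the linear part in the
neutrix part of `ξ`. -/
def IsModularPart (ξ M : Set V) : Prop :=
  IsNeutrix R M ∧ linearPart R ξ + M = neutrixPart ξ ∧ linearPart R ξ ∩ M = {0}

/-- `d` is the dimension of `N`: the maximal number of elements of a linearly independent
subset of `N`. -/
def HasDim (N : Set V) (d : ℕ) : Prop :=
  IsGreatest {k : ℕ | ∃ z : Finset V,
    (z : Set V) ⊆ N ∧ LinearIndepOn R id (z : Set V) ∧ z.card = k} d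

end Neutrices

/-- An external number is the Minkowski sum of an element of `R` and a neutrix of `R`. -/
@[ext] structure ExternalNumber (R : Type*) [Field R] [LinearOrder R] where
  carrier : Set R
  isExternal : IsExternalPoint R carrier

namespace ExternalNumber

variable {R : Type*} [Field R] [LinearOrder R]

/-- The neutrix part of an external number. -/
def neutrix (α : ExternalNumber R) : Set R := neutrixPart α.carrier

/-- An external number is neutricial if it is equal to its neutrix part. -/
def IsNeutricial (α : ExternalNumber R) : Prop := α.carrier = α.neutrix

theorem isNeutrix_zero : IsNeutrix R ({0} : Set R) :=
  ⟨⟨⊥, by simp⟩, convex_singleton 0⟩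

/-- Elements of `R` as external numbers. -/
def ofField (a : R) : ExternalNumber R :=
  ⟨{a}, a, {0}, isNeutrix_zero, by simp⟩

/-- Minkowski sum of external numbers. -/
instance : Add (ExternalNumber R) where
  add α β := ⟨α.carrier + β.carrier, by
    obtain ⟨a, A, ⟨⟨G, rfl⟩, hA⟩, hα⟩ := α.isExternal
    obtain ⟨b, B, ⟨⟨G', rfl⟩, hB⟩, hβ⟩ := β.isExternal
    refine ⟨a + b, (G : Set R) + (G' : Set R), ⟨⟨G ⊔ G', ?_⟩, hA.add hB⟩, ?_⟩
    · exact AddSubgroup.add_normal G G'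
    · rw [hα, hβ, add_add_add_comm, Set.singleton_add_singleton]⟩

/-- Minkowski product of an element of `R` and an external number. -/
instance : SMul R (ExternalNumber R) where
  smul c α := ⟨c • α.carrier, by
    obtain ⟨a, A, ⟨⟨G, rfl⟩, hA⟩, hα⟩ := α.isExternal
    refine ⟨c • a, c • (G : Set R), ⟨⟨G.map (DistribSMul.toAddMonoidHom R c), ?_⟩, hA.smul c⟩, ?_⟩
    · ext x; simp [Set.mem_smul_set]
    · rw [hα, smul_add, Set.smul_set_singleton]⟩

theorem isNeutrix_neutrix (α : ExternalNumber R) : IsNeutrix R α.neutrix := by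
  obtain ⟨a, A, ⟨⟨G, rfl⟩, hA⟩, hα⟩ := α.isExternal
  have h : α.neutrix = (G : Set R) := by
    unfold ExternalNumber.neutrix neutrixPart
    rw [hα]
    ext x
    simp only [Set.mem_sub, Set.singleton_add, Set.mem_image, SetLike.mem_coe]
    constructor
    · rintro ⟨_, ⟨g, hg, rfl⟩, _, ⟨g', hg', rfl⟩, rfl⟩
      simpa using G.sub_mem hg hg'
    · intro hx
      exact ⟨a + x, ⟨x, hx, rfl⟩, a + 0, ⟨0, G.zero_mem, rfl⟩, by simp⟩
  rw [h]
  exact ⟨⟨G, rfl⟩, hA⟩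

end ExternalNumber

section Systems

variable {R : Type*} [Field R] [LinearOrder R] {m n p q : ℕ}

/-- The element `(α₁ x₁ + ⋯ + αₙ xₙ)` of `𝒜 x`, for the row `i` of `𝒜`. -/
def rowApply (A : Matrix (Fin m) (Fin n) (ExternalNumber R)) (x : Fin n → R) (i : Fin m) : Set R :=
  ∑ j, (A i j).carrier * {x j}

/-- The solution of the flexible system `𝒜 x ⊆ ℬ`. -/
def solutionSet (A : Matrix (Fin m) (Fin n) (ExternalNumber R)) (B : Fin m → ExternalNumber R) :
    Set (Fin n → R) :=
  {x | ∀ i, rowApply A x i ⊆ (B i).carrier}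

/-- The solution `ξ` of `𝒜 x ⊆ ℬ` is exact if `𝒜 ξ = ℬ`, where the external vector `ℬ` is
identified with the set of its representative vectors. -/
def IsExact (A : Matrix (Fin m) (Fin n) (ExternalNumber R)) (B : Fin m → ExternalNumber R) :
    Prop :=
  {z : Fin m → R | ∃ x ∈ solutionSet A B, ∀ i, z i ∈ rowApply A x i} =
    {z : Fin m → R | ∀ i, z i ∈ (B i).carrier}

/-- A matrix over `R` as an external matrix. -/
def toExternal (P : Matrix (Fin m) (Fin n) R) : Matrix (Fin m) (Fin n) (ExternalNumber R) :=
  P.map ExternalNumber.ofField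

/-- `P` is a representative matrix of `𝒜`. -/
def IsRepresentative (A : Matrix (Fin m) (Fin n) (ExternalNumber R))
    (P : Matrix (Fin m) (Fin n) R) : Prop :=
  ∀ i j, P i j ∈ (A i j).carrier

/-- `H`-equivalence of `𝒜 x ⊆ ℬ` and `𝒜' y ⊆ ℬ'`, where `y = H x`. -/
def HEquivalent (H : Matrix (Fin n) (Fin n) R)
    (A : Matrix (Fin p) (Fin n) (ExternalNumber R)) (B : Fin p → ExternalNumber R)
    (A' : Matrix (Fin q) (Fin n) (ExternalNumber R)) (B' : Fin q → ExternalNumber R) : Prop :=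
  ∀ x y : Fin n → R, y = H.mulVec x → (x ∈ solutionSet A B ↔ y ∈ solutionSet A' B')

/-- The quotient `B : A = {c | c A ⊆ B}`. -/
def neutrixQuotient (B A : Set R) : Set R := {c | c • A ⊆ B}

/-- The component `F_j = min_i (B_i : A_ij)` of the feasibility space. Neutrices of `R` are
totally ordered by inclusion, so that the minimum is the intersection. -/
def feasibility (A : Matrix (Fin m) (Fin n) (ExternalNumber R)) (B : Fin m → ExternalNumber R)
    (j : Fin n) : Set R :=
  ⋂ i, neutrixQuotient (B i).neutrix (A i j).neutrix

open Classical in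
/-- The indices `j` such that `F_j` is strictly included in `R`. -/
noncomputable def constraintIndices (A : Matrix (Fin m) (Fin n) (ExternalNumber R))
    (B : Fin m → ExternalNumber R) : Finset (Fin n) :=
  Finset.univ.filter fun j => feasibility A B j ≠ Set.univ

/-- The constraint dimension `k`. -/
noncomputable def constraintDim (A : Matrix (Fin m) (Fin n) (ExternalNumber R))
    (B : Fin m → ExternalNumber R) : ℕ :=
  (constraintIndices A B).card

/-- The increasing enumeration `j_1 < ⋯ < j_k` of the constraint indices. -/
noncomputable def constraintIndex (A : Matrix (Fin m) (Fin n) (ExternalNumber R))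
    (B : Fin m → ExternalNumber R) (h : Fin (constraintDim A B)) : Fin n :=
  (constraintIndices A B).orderEmbOfFin rfl h

/-- The constraint matrix `K`. -/
noncomputable def constraintMatrix (A : Matrix (Fin m) (Fin n) (ExternalNumber R))
    (B : Fin m → ExternalNumber R) : Matrix (Fin (constraintDim A B)) (Fin n) R :=
  Matrix.of fun h l => if l = constraintIndex A B h then 1 else 0

/-- The coefficient matrix of the integrated system associated to `𝒜 x ⊆ ℬ` by `P`: the rows of
`P`, followed by those of `K`. -/
noncomputable def integratedMatrix (A : Matrix (Fin m) (Fin n) (ExternalNumber R))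
    (B : Fin m → ExternalNumber R) (P : Matrix (Fin m) (Fin n) R) :
    Matrix (Fin (m + constraintDim A B)) (Fin n) R :=
  Matrix.of (Fin.append P (constraintMatrix A B))

/-- `Q y ∈ 𝒞` is in increasing row-echelon form: `Q` has rank at least `1`, is in row-echelon form
with diagonal entries equal to `1` exactly in the first `Q.rank` rows, is reduced (its first entry
is `1` and all entries are at most `1` in absolute value), and the neutrix parts of the first
`Q.rank` components of `𝒞` are increasing. -/
structure IsIncreasingRowEchelon (Q : Matrix (Fin p) (Fin n) R) (C : Fin p → ExternalNumber R) :
    Prop where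
  one_le_rank : 1 ≤ Q.rank
  isRowEchelon : Q.IsRowEchelon
  first_eq_one : ∀ (i : Fin p) (j : Fin n), i.val = 0 → j.val = 0 → Q i j = 1
  abs_le_one : ∀ i j, |Q i j| ≤ 1
  diag_eq_one_iff : ∀ (i : Fin p) (j : Fin n), i.val = j.val → (Q i j = 1 ↔ i.val < Q.rank)
  increasing : ∀ i i' : Fin p, i ≤ i' → i'.val < Q.rank → (C i).neutrix ⊆ (C i').neutrix

/-- `GaussianElim P B σ Q C` means that the system `Q y ∈ C` is obtained from the system `P x ∈ B`
by Gaussian elimination: a finite sequence of row interchanges, multiplications of a row by a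
nonzero element, additions of a multiple of a row to another row (all of them performed on the
coefficient matrix and on the right-hand side), and column interchanges. The permutation `σ`
records the column interchanges: `y = H x` with `H = σ.permMatrix R`, i.e. `y i = x (σ i)`. -/
inductive GaussianElim (P : Matrix (Fin p) (Fin n) R) (B : Fin p → ExternalNumber R) :
    Equiv.Perm (Fin n) → Matrix (Fin p) (Fin n) R → (Fin p → ExternalNumber R) → Prop
  | refl : GaussianElim P B 1 P B
  | swapRows {σ : Equiv.Perm (Fin n)} {Q : Matrix (Fin p) (Fin n) R}
      {C : Fin p → ExternalNumber R} (i i' : Fin p) :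
      GaussianElim P B σ Q C →
      GaussianElim P B σ (Q.submatrix (Equiv.swap i i') id) (C ∘ Equiv.swap i i')
  | scaleRow {σ : Equiv.Perm (Fin n)} {Q : Matrix (Fin p) (Fin n) R}
      {C : Fin p → ExternalNumber R} (i : Fin p) (c : R) (hc : c ≠ 0) :
      GaussianElim P B σ Q C →
      GaussianElim P B σ (Q.updateRow i (c • Q i)) (Function.update C i (c • C i))
  | addRow {σ : Equiv.Perm (Fin n)} {Q : Matrix (Fin p) (Fin n) R}
      {C : Fin p → ExternalNumber R} (i i' : Fin p) (hi : i ≠ i') (c : R) :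
      GaussianElim P B σ Q C →
      GaussianElim P B σ (Q.updateRow i (Q i + c • Q i')) (Function.update C i (C i + c • C i'))
  | swapCols {σ : Equiv.Perm (Fin n)} {Q : Matrix (Fin p) (Fin n) R}
      {C : Fin p → ExternalNumber R} (j j' : Fin n) :
      GaussianElim P B σ Q C →
      GaussianElim P B (σ * Equiv.swap j j') (Q.submatrix id (Equiv.swap j j')) C

/-- The block `Q^(r)` of the first `r` rows and columns, where `r` is the rank of `Q`. -/
noncomputable def leadingBlock (Q : Matrix (Fin p) (Fin n) R) :
    Matrix (Fin Q.rank) (Fin Q.rank) R :=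
  Q.submatrix (Fin.castLE Q.rank_le_height) (Fin.castLE Q.rank_le_width)

/-- The first `r` rows of `Q`, where `r` is the rank of `Q`. -/
noncomputable def leadingRows (Q : Matrix (Fin p) (Fin n) R) : Matrix (Fin Q.rank) (Fin n) R :=
  Q.submatrix (Fin.castLE Q.rank_le_height) id

/-- The first `r` components of a column vector, where `r` is the rank of `Q`. -/
noncomputable def leadingPart {X : Type*} (Q : Matrix (Fin p) (Fin n) R) (c : Fin p → X) : Fin Q.rank → X :=
  fun i => c (Fin.castLE Q.rank_le_height i)

/-- The vector `(v, 0)` of `R ^ n`, for `v` in `R ^ r`. -/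
def extendZero {r : ℕ} (n : ℕ) (v : Fin r → R) : Fin n → R :=
  fun l => if h : l.val < r then v ⟨l.val, h⟩ else 0

/-- The vector `(-(Q^(r))⁻¹ q_k^r, e_{k-r})` of `R ^ n`, where `r` is the rank of `Q` and `k` is
the index of a column (meaningful if `k` is not among the first `r` columns). -/
noncomputable def kernelVector (Q : Matrix (Fin p) (Fin n) R) (k : Fin n) : Fin n → R :=
  fun l => if h : l.val < Q.rank then
      -((leadingBlock Q)⁻¹.mulVec (leadingPart Q fun i => Q i k)) ⟨l.val, h⟩
    else if l = k then 1 else 0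

/-- The support vector `((Q^(r))⁻¹ c^r, 0)`. -/
noncomputable def supportVector (Q : Matrix (Fin p) (Fin n) R) (c : Fin p → R) : Fin n → R :=
  extendZero n ((leadingBlock Q)⁻¹.mulVec (leadingPart Q c))

/-- The set `∑_{i ≤ r} C_i ((Q^(r))⁻¹ e_i, 0)`. -/
noncomputable def modularSum (Q : Matrix (Fin p) (Fin n) R) (C : Fin p → ExternalNumber R) :
    Set (Fin n → R) :=
  ∑ i : Fin Q.rank, (leadingPart Q C i).neutrix •
    ({extendZero n ((leadingBlock Q)⁻¹.mulVec (Pi.single i 1))} : Set (Fin n → R))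

/-- The set `∑_{r < k ≤ n} R (-(Q^(r))⁻¹ q_k^r, e_{k-r})`. -/
noncomputable def linearSum (Q : Matrix (Fin p) (Fin n) R) : Set (Fin n → R) :=
  ∑ k : Fin n with Q.rank ≤ k.val, (Set.univ : Set R) • ({kernelVector Q k} : Set (Fin n → R))

/-- The number of nonzero neutrices among the neutrix parts `C_1, …, C_r`, where `r` is the rank
of `Q`. -/
noncomputable def numNonzeroNeutrices (Q : Matrix (Fin p) (Fin n) R)
    (C : Fin p → ExternalNumber R) : ℕ :=
  {i : Fin Q.rank | (leadingPart Q C i).neutrix ≠ {0}}.ncard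

end Systems

section Integrated

variable {R : Type*} [Field R] [LinearOrder R] {m n : ℕ}

theorem isNeutrix_feasibility (A : Matrix (Fin m) (Fin n) (ExternalNumber R))
    (B : Fin m → ExternalNumber R) (j : Fin n) : IsNeutrix R (feasibility A B j) := by
  have key : ∀ c, c ∈ feasibility A B j ↔
      ∀ i, ∀ a ∈ (A i j).neutrix, c * a ∈ (B i).neutrix := by
    intro c
    simp only [feasibility, neutrixQuotient, Set.mem_iInter, Set.mem_ofPred_eq,
      Set.subset_def, Set.mem_smul_set]
    constructor
    · intro h i a ha
      exact h i _ ⟨a, ha, rfl⟩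
    · rintro h i _ ⟨a, ha, rfl⟩
      exact h i a ha
  constructor
  · refine ⟨⟨⟨⟨feasibility A B j, ?_⟩, ?_⟩, ?_⟩, rfl⟩
    · intro c d hc hd
      rw [key] at *
      intro i a ha
      obtain ⟨⟨G, hG⟩, -⟩ := (B i).isNeutrix_neutrix
      have h1 := hc i a ha
      have h2 := hd i a ha
      rw [← hG] at *
      rw [add_mul]
      exact G.add_mem h1 h2
    · change (0 : R) ∈ feasibility A B j
      rw [key]
      intro i a ha
      obtain ⟨⟨G, hG⟩, -⟩ := (B i).isNeutrix_neutrix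
      rw [← hG, zero_mul]
      exact G.zero_mem
    · intro c hc
      change -c ∈ feasibility A B j
      have hc' : c ∈ feasibility A B j := hc
      rw [key] at *
      intro i a ha
      obtain ⟨⟨G, hG⟩, -⟩ := (B i).isNeutrix_neutrix
      have h1 := hc' i a ha
      rw [← hG] at *
      rw [neg_mul]
      exact G.neg_mem h1
  · intro c hc d hd s t hs ht hst
    rw [key] at *
    intro i a ha
    have h := (B i).isNeutrix_neutrix.2 (hc i a ha) (hd i a ha) hs ht hst
    have e : (s • c + t • d) * a = s • (c * a) + t • (d * a) := by
      simp only [smul_eq_mul]; ring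
    rw [e]
    exact h

/-- The constraint `ℱ^(c) = (F_{j_1}, …, F_{j_k})`. -/
noncomputable def constraint (A : Matrix (Fin m) (Fin n) (ExternalNumber R))
    (B : Fin m → ExternalNumber R) : Fin (constraintDim A B) → ExternalNumber R :=
  fun h => ⟨feasibility A B (constraintIndex A B h),
    0, feasibility A B (constraintIndex A B h), isNeutrix_feasibility A B _, by simp⟩

/-- The right-hand side of the integrated system associated to `𝒜 x ⊆ ℬ`. -/
noncomputable def integratedRHS (A : Matrix (Fin m) (Fin n) (ExternalNumber R))
    (B : Fin m → ExternalNumber R) : Fin (m + constraintDim A B) → ExternalNumber R :=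
  Fin.append B (constraint A B)

/-- `Q y ∈ 𝒞`, where `y = H x` with `H = σ.permMatrix R`, is a system in increasing row-echelon
form associated to `𝒜 x ⊆ ℬ` by `P`: it is in increasing row-echelon form, obtained by Gaussian
elimination from the integrated system associated by `P`, and `H`-equivalent to that system. -/
def IsAssociated (A : Matrix (Fin m) (Fin n) (ExternalNumber R)) (B : Fin m → ExternalNumber R)
    (P : Matrix (Fin m) (Fin n) R) (σ : Equiv.Perm (Fin n))
    (Q : Matrix (Fin (m + constraintDim A B)) (Fin n) R)
    (C : Fin (m + constraintDim A B) → ExternalNumber R) : Prop :=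
  IsIncreasingRowEchelon Q C ∧
    GaussianElim (integratedMatrix A B P) (integratedRHS A B) σ Q C ∧
    HEquivalent (σ.permMatrix R) (toExternal (integratedMatrix A B P)) (integratedRHS A B)
      (toExternal Q) C

end Integrated

/-! Fix a representative matrix `P` and write each coefficient as `P i j` plus a deviation in the
neutrix A_ij. Varying one coefficient at a time shows that x solves the flexible system iff Px lies
in ℬ and each product a x_j with a in A_ij lies in B_i, that is, x_j lies in F_j
(`mem_solutionSet_iff`). Conditions with F_j = R are void, and what remains is the integrated
system, whose coefficients are precise.

Elimination on such a system can lose information: adding c times row i' to row i replaces C_i by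
C_i + cC_i', which may enlarge the solution. Nothing is lost if cC_i' ⊆ C_i (`EquivElim.addRow`).
Neutrices of R are totally ordered by inclusion, so one can divide each remaining nonzero row by its
largest entry and choose as pivot row the one whose neutrix becomes smallest (`exists_pivot`).
Clearing below this pivot is then lossless, the entries of the pivot row become at most 1 in
absolute value, and the neutrices of successive pivot rows increase (`IsPartialEchelon.step`).

In echelon form the leading r × r block is unitriangular and all rows after the r-th vanish. Hence,
when the remaining γ_i contain 0, the solution is the preimage of γ_1 × ⋯ × γ_r under the first r
rows. The section v ↦ ((Q^(r))⁻¹ v, 0) of these rows, together with a basis of their kernel, gives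
the closed formula (`eq_supportMap_add_sum`). Elimination never creates the neutrix R, so no line
outside this kernel fits into the neutrix part: the linear part is the kernel.

The neutrix part and the linear part of ξ depend on ξ alone, hence not on `P`. Every modular part
spans a complement of the linear part in the span of the neutrix part, so all modular parts have the
same dimension (`finrank_span_add_finrank`), which identifies the number of nonzero C_i. The rank is
invariant because two representative matrices differ only in columns that K forces to be multiplied
by 0 on the kernel (`integratedMatrix_rank_eq`). -/

/-! ### Neutrices: stability under small scalars and total order. -/

section NeutrixBasics

variable {R : Type*} [Field R] [LinearOrder R] {V : Type*} [AddCommGroup V] [Module R V]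
  {N : Set V}

namespace IsNeutrix

theorem zero_mem (hN : IsNeutrix R N) : (0 : V) ∈ N := by
  obtain ⟨⟨G, rfl⟩, -⟩ := hN
  exact G.zero_mem

theorem add_mem (hN : IsNeutrix R N) {x y : V} (hx : x ∈ N) (hy : y ∈ N) : x + y ∈ N := by
  obtain ⟨⟨G, rfl⟩, -⟩ := hN
  exact G.add_mem hx hy

theorem neg_mem (hN : IsNeutrix R N) {x : V} (hx : x ∈ N) : -x ∈ N := by
  obtain ⟨⟨G, rfl⟩, -⟩ := hN
  exact G.neg_mem hx

theorem sub_mem (hN : IsNeutrix R N) {x y : V} (hx : x ∈ N) (hy : y ∈ N) : x - y ∈ N := by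
  obtain ⟨⟨G, rfl⟩, -⟩ := hN
  exact G.sub_mem hx hy

theorem sum_mem (hN : IsNeutrix R N) {ι : Type*} (s : Finset ι) {f : ι → V}
    (hf : ∀ i ∈ s, f i ∈ N) : ∑ i ∈ s, f i ∈ N := by
  obtain ⟨⟨G, rfl⟩, -⟩ := hN
  exact G.sum_mem hf

/-- For t in [0, 1] the vector t x is a convex combination of x and 0; negation handles t in [-1,
0]. -/
theorem smul_mem [IsStrictOrderedRing R] (hN : IsNeutrix R N) {t : R} (ht : |t| ≤ 1) {x : V}
    (hx : x ∈ N) : t • x ∈ N := by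
  have key : ∀ s : R, 0 ≤ s → s ≤ 1 → s • x ∈ N := fun s hs hs1 => by
    simpa using hN.2 hx hN.zero_mem hs (sub_nonneg.2 hs1) (by ring)
  rcases le_total 0 t with h | h
  · exact key t h (by rwa [abs_of_nonneg h] at ht)
  · rw [abs_of_nonpos h] at ht
    simpa using hN.neg_mem (key (-t) (by simpa using h) ht)

theorem of_mem [IsStrictOrderedRing R] (h0 : (0 : V) ∈ N)
    (hadd : ∀ x ∈ N, ∀ y ∈ N, x + y ∈ N) (hsmul : ∀ t : R, |t| ≤ 1 → ∀ x ∈ N, t • x ∈ N) :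
    IsNeutrix R N := by
  refine ⟨⟨⟨⟨⟨N, fun {x y} hx hy => hadd x hx y hy⟩, h0⟩, fun {x} hx => ?_⟩, rfl⟩, ?_⟩
  · simpa using hsmul (-1) (by simp) x hx
  · intro x hx y hy a b ha hb hab
    exact hadd _ (hsmul a (by rw [abs_of_nonneg ha]; linarith) x hx) _
      (hsmul b (by rw [abs_of_nonneg hb]; linarith) y hy)

theorem neutrixPart_singleton_add (hN : IsNeutrix R N) (p : V) :
    neutrixPart ({p} + N) = N := by
  ext x
  simp only [neutrixPart, Set.mem_sub, Set.singleton_add, Set.mem_image]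
  constructor
  · rintro ⟨_, ⟨a, ha, rfl⟩, _, ⟨b, hb, rfl⟩, rfl⟩
    simpa using hN.sub_mem ha hb
  · intro hx
    exact ⟨p + x, ⟨x, hx, rfl⟩, p + 0, ⟨0, hN.zero_mem, rfl⟩, by simp⟩

theorem mul_mem_of_abs_le [IsStrictOrderedRing R] {N : Set R} (hN : IsNeutrix R N) {s t x : R}
    (hst : |s| ≤ |t|) (hx : t * x ∈ N) : s * x ∈ N := by
  rcases eq_or_ne t 0 with rfl | ht
  · have : s = 0 := by simpa using hst
    simpa [this] using hN.zero_mem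
  · have := hN.smul_mem (t := s / t) (by rw [abs_div]; exact div_le_one_of_le₀ hst (abs_nonneg t)) hx
    rwa [smul_eq_mul, ← mul_assoc, div_mul_cancel₀ s ht] at this

/-- If each set had an element outside the other, the one of smaller absolute value would be a
multiple of the other by a factor in [-1, 1]. This fails in higher dimension; it is what makes a
best pivot available. -/
theorem subset_total [IsStrictOrderedRing R] {M N : Set R} (hM : IsNeutrix R M)
    (hN : IsNeutrix R N) : M ⊆ N ∨ N ⊆ M := by
  by_contra! h
  obtain ⟨x, hx, hxN⟩ := Set.not_subset.1 h.1
  obtain ⟨y, hy, hyM⟩ := Set.not_subset.1 h.2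
  rcases le_total |x| |y| with hxy | hxy
  · exact hxN (by simpa using hN.mul_mem_of_abs_le (x := 1) hxy (by simpa using hy))
  · exact hyM (by simpa using hM.mul_mem_of_abs_le (x := 1) hxy (by simpa using hx))

end IsNeutrix

end NeutrixBasics

/-! ### Arithmetic of external numbers and of their neutrix parts. -/

namespace ExternalNumber

variable {R : Type*} [Field R] [LinearOrder R] {α β : ExternalNumber R} {a x c : R}

theorem nonempty_carrier (α : ExternalNumber R) : α.carrier.Nonempty := by
  obtain ⟨a, A, hA, hα⟩ := α.isExternal
  exact ⟨a + 0, hα ▸ Set.add_mem_add rfl hA.zero_mem⟩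

/-- Any element of an external number can serve as its representative. -/
theorem mem_carrier_iff (ha : a ∈ α.carrier) : x ∈ α.carrier ↔ x - a ∈ α.neutrix := by
  refine ⟨fun hx => Set.sub_mem_sub hx ha, fun hx => ?_⟩
  obtain ⟨b, A, hA, hα⟩ := α.isExternal
  have hN : α.neutrix = A := by
    rw [ExternalNumber.neutrix, hα, hA.neutrixPart_singleton_add]
  rw [hN] at hx
  rw [hα, Set.singleton_add, Set.mem_image] at ha ⊢
  obtain ⟨a', ha', rfl⟩ := ha
  exact ⟨a' + (x - (b + a')), hA.add_mem ha' hx, by ring⟩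

theorem isNeutricial_iff : α.IsNeutricial ↔ (0 : R) ∈ α.carrier := by
  constructor
  · intro h
    rw [IsNeutricial] at h
    rw [h]
    exact α.isNeutrix_neutrix.zero_mem
  · intro h
    ext x
    rw [mem_carrier_iff h, sub_zero]

theorem mem_add : x ∈ (α + β).carrier ↔ ∃ a ∈ α.carrier, ∃ b ∈ β.carrier, a + b = x :=
  Set.mem_add

theorem mem_smul : x ∈ (c • α).carrier ↔ ∃ a ∈ α.carrier, c * a = x :=
  Set.mem_smul_set

theorem mem_neutrix_add :
    x ∈ (α + β).neutrix ↔ ∃ a ∈ α.neutrix, ∃ b ∈ β.neutrix, a + b = x := by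
  obtain ⟨a, ha⟩ := α.nonempty_carrier
  obtain ⟨b, hb⟩ := β.nonempty_carrier
  have hab : a + b ∈ (α + β).carrier := mem_add.2 ⟨a, ha, b, hb, rfl⟩
  have hx : x ∈ (α + β).neutrix ↔ a + b + x ∈ (α + β).carrier := by
    rw [mem_carrier_iff hab, add_sub_cancel_left]
  rw [hx, mem_add]
  constructor
  · rintro ⟨a', ha', b', hb', h⟩
    exact ⟨a' - a, (mem_carrier_iff ha).1 ha', b' - b, (mem_carrier_iff hb).1 hb',
      by linear_combination h⟩
  · rintro ⟨a', ha', b', hb', rfl⟩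
    exact ⟨a + a', (mem_carrier_iff ha).2 (by simpa using ha'), b + b',
      (mem_carrier_iff hb).2 (by simpa using hb'), by ring⟩

theorem mem_neutrix_smul : x ∈ (c • α).neutrix ↔ ∃ a ∈ α.neutrix, c * a = x := by
  obtain ⟨a, ha⟩ := α.nonempty_carrier
  have hca : c * a ∈ (c • α).carrier := mem_smul.2 ⟨a, ha, rfl⟩
  have hx : x ∈ (c • α).neutrix ↔ c * a + x ∈ (c • α).carrier := by
    rw [mem_carrier_iff hca, add_sub_cancel_left]
  rw [hx, mem_smul]
  constructor
  · rintro ⟨a', ha', h⟩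
    exact ⟨a' - a, (mem_carrier_iff ha).1 ha', by linear_combination h⟩
  · rintro ⟨a', ha', rfl⟩
    exact ⟨a + a', (mem_carrier_iff ha).2 (by simpa using ha'), by ring⟩

theorem neutrix_add_of_subset (h : β.neutrix ⊆ α.neutrix) : (α + β).neutrix = α.neutrix := by
  ext x
  rw [mem_neutrix_add]
  constructor
  · rintro ⟨a, ha, b, hb, rfl⟩
    exact α.isNeutrix_neutrix.add_mem ha (h hb)
  · exact fun hx => ⟨x, hx, 0, β.isNeutrix_neutrix.zero_mem, add_zero x⟩

/-- By total order the sum of two neutrices is the larger one; in particular addition cannot produce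
R from smaller neutrices. -/
theorem neutrix_add_eq_or [IsStrictOrderedRing R] (α β : ExternalNumber R) :
    (α + β).neutrix = α.neutrix ∨ (α + β).neutrix = β.neutrix := by
  have hcomm : α + β = β + α := ExternalNumber.ext (add_comm α.carrier β.carrier)
  rcases α.isNeutrix_neutrix.subset_total β.isNeutrix_neutrix with h | h
  · exact Or.inr (hcomm ▸ neutrix_add_of_subset h)
  · exact Or.inl (neutrix_add_of_subset h)

theorem neutrix_smul_ne_univ (hα : α.neutrix ≠ Set.univ) : (c • α).neutrix ≠ Set.univ := by
  intro h
  rcases eq_or_ne c 0 with rfl | hc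
  · obtain ⟨a, -, ha⟩ := mem_neutrix_smul.1 (h ▸ Set.mem_univ (1 : R))
    simp at ha
  · refine hα (Set.eq_univ_of_forall fun x => ?_)
    obtain ⟨a, ha, hx⟩ := mem_neutrix_smul.1 (h ▸ Set.mem_univ (c * x))
    rwa [← mul_left_cancel₀ hc hx]

end ExternalNumber

theorem Matrix.rank_eq_of_mulVec_eq_zero_iff {R : Type*} [Field R] {n p q : ℕ}
    {P : Matrix (Fin p) (Fin n) R}
    {Q : Matrix (Fin q) (Fin n) R} (h : ∀ x, P.mulVec x = 0 ↔ Q.mulVec x = 0) :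
    P.rank = Q.rank := by
  have hker : LinearMap.ker P.mulVecLin = LinearMap.ker Q.mulVecLin := by
    ext x; simpa using h x
  have h1 := P.mulVecLin.finrank_range_add_finrank_ker
  have h2 := Q.mulVecLin.finrank_range_add_finrank_ker
  rw [Matrix.rank, Matrix.rank]
  rw [hker] at h1
  omega

/-! ### Reduction of a flexible system to its integrated system. -/

section SolutionSets

variable {R : Type*} [Field R] [LinearOrder R] {m n p : ℕ}

theorem mem_rowApply {A : Matrix (Fin m) (Fin n) (ExternalNumber R)} {x : Fin n → R} {i : Fin m}
    {z : R} : z ∈ rowApply A x i ↔ ∃ a : Fin n → R, (∀ j, a j ∈ (A i j).carrier) ∧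
      ∑ j, a j * x j = z := by
  simp only [rowApply, Set.mem_fintype_sum, Set.mem_mul, Set.mem_singleton_iff]
  constructor
  · rintro ⟨g, hg, rfl⟩
    choose a ha b hb hab using fun j => @hg j
    refine ⟨a, ha, Finset.sum_congr rfl fun j _ => ?_⟩
    rw [← hab j, hb j]
  · rintro ⟨a, ha, rfl⟩
    exact ⟨fun j => a j * x j, fun {j} => ⟨a j, ha j, x j, rfl, rfl⟩, rfl⟩

theorem rowApply_toExternal (Q : Matrix (Fin p) (Fin n) R) (y : Fin n → R) (i : Fin p) :
    rowApply (toExternal Q) y i = {Q.mulVec y i} := by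
  ext z
  rw [mem_rowApply, Set.mem_singleton_iff]
  constructor
  · rintro ⟨a, ha, rfl⟩
    refine Finset.sum_congr rfl fun j _ => ?_
    rw [show a j = Q i j from ha j]
  · rintro rfl
    exact ⟨Q i, fun j => rfl, rfl⟩

theorem mem_solutionSet_toExternal {Q : Matrix (Fin p) (Fin n) R} {C : Fin p → ExternalNumber R}
    {y : Fin n → R} :
    y ∈ solutionSet (toExternal Q) C ↔ ∀ i, Q.mulVec y i ∈ (C i).carrier := by
  simp [solutionSet, rowApply_toExternal]

theorem mem_feasibility {A : Matrix (Fin m) (Fin n) (ExternalNumber R)}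
    {B : Fin m → ExternalNumber R} {j : Fin n} {c : R} :
    c ∈ feasibility A B j ↔ ∀ i, ∀ a ∈ (A i j).neutrix, c * a ∈ (B i).neutrix := by
  simp only [feasibility, neutrixQuotient, Set.mem_iInter, Set.mem_ofPred_eq, Set.subset_def,
    Set.mem_smul_set]
  exact ⟨fun h i a ha => h i _ ⟨a, ha, rfl⟩, fun h i _ ⟨a, ha, hx⟩ => hx ▸ h i a ha⟩

theorem mem_constraintIndices {A : Matrix (Fin m) (Fin n) (ExternalNumber R)}
    {B : Fin m → ExternalNumber R} {j : Fin n} :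
    j ∈ constraintIndices A B ↔ feasibility A B j ≠ Set.univ := by
  simp [constraintIndices]

theorem forall_constraintIndex {A : Matrix (Fin m) (Fin n) (ExternalNumber R)}
    {B : Fin m → ExternalNumber R} {p : Fin n → Prop} :
    (∀ h, p (constraintIndex A B h)) ↔ ∀ j, feasibility A B j ≠ Set.univ → p j := by
  constructor
  · intro h j hj
    have : j ∈ Set.range ((constraintIndices A B).orderEmbOfFin rfl) := by
      rw [Finset.range_orderEmbOfFin]
      exact mem_constraintIndices.2 hj
    obtain ⟨i, rfl⟩ := this
    exact h i
  · intro h i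
    exact h _ (mem_constraintIndices.1 (Finset.orderEmbOfFin_mem _ rfl i))

theorem integratedMatrix_mulVec_castAdd (A : Matrix (Fin m) (Fin n) (ExternalNumber R))
    (B : Fin m → ExternalNumber R) (P : Matrix (Fin m) (Fin n) R) (x : Fin n → R) (i : Fin m) :
    (integratedMatrix A B P).mulVec x (Fin.castAdd _ i) = P.mulVec x i :=
  congrArg (· ⬝ᵥ x) (Fin.append_left P (constraintMatrix A B) i)

theorem integratedMatrix_mulVec_natAdd (A : Matrix (Fin m) (Fin n) (ExternalNumber R))
    (B : Fin m → ExternalNumber R) (P : Matrix (Fin m) (Fin n) R) (x : Fin n → R)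
    (h : Fin (constraintDim A B)) :
    (integratedMatrix A B P).mulVec x (Fin.natAdd _ h) = x (constraintIndex A B h) := by
  refine (congrArg (· ⬝ᵥ x) (Fin.append_right P (constraintMatrix A B) h)).trans ?_
  simp [constraintMatrix, dotProduct]

theorem constraint_neutrix (A : Matrix (Fin m) (Fin n) (ExternalNumber R))
    (B : Fin m → ExternalNumber R) (h : Fin (constraintDim A B)) :
    (constraint A B h).neutrix = feasibility A B (constraintIndex A B h) := by
  have := (isNeutrix_feasibility A B (constraintIndex A B h)).neutrixPart_singleton_add 0
  rwa [Set.singleton_zero, zero_add] at this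

/-- The row sum for coefficients a differs from that for `P` by ∑ x_j (a_j - P_ij), a sum of terms
from x_j A_ij. It stays in B_i for all choices iff each term does, since B_i is a group. -/
theorem mem_solutionSet_iff {A : Matrix (Fin m) (Fin n) (ExternalNumber R)}
    {B : Fin m → ExternalNumber R} {P : Matrix (Fin m) (Fin n) R} (hP : IsRepresentative A P)
    {x : Fin n → R} : x ∈ solutionSet A B ↔
      (∀ i, P.mulVec x i ∈ (B i).carrier) ∧ ∀ j, x j ∈ feasibility A B j := by
  have hsum : ∀ i, ∀ a : Fin n → R,
      ∑ j, a j * x j - P.mulVec x i = ∑ j, x j * (a j - P i j) := fun i a => by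
    rw [Matrix.mulVec, dotProduct, ← Finset.sum_sub_distrib]
    exact Finset.sum_congr rfl fun j _ => by ring
  constructor
  · intro hx
    have hPx : ∀ i, P.mulVec x i ∈ (B i).carrier := fun i =>
      hx i (mem_rowApply.2 ⟨P i, hP i, rfl⟩)
    refine ⟨hPx, fun j => mem_feasibility.2 fun i a ha => ?_⟩
    -- Perturb only the coefficient in column j, by a; subtracting the unperturbed row isolates x_j
    -- a.
    have h : ∑ l, (P i l + Pi.single (M := fun _ => R) j a l) * x l ∈ (B i).carrier := by
      refine hx i (mem_rowApply.2 ⟨fun l => P i l + Pi.single (M := fun _ => R) j a l, fun l => ?_, rfl⟩)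
      rcases eq_or_ne l j with rfl | hl
      · exact (ExternalNumber.mem_carrier_iff (hP i l)).2 (by simpa using ha)
      · simpa [hl] using hP i l
    rw [ExternalNumber.mem_carrier_iff (hPx i), hsum] at h
    simpa [Pi.single_apply] using h
  · rintro ⟨hPx, hF⟩ i z hz
    obtain ⟨a, ha, rfl⟩ := mem_rowApply.1 hz
    rw [ExternalNumber.mem_carrier_iff (hPx i), hsum]
    exact (B i).isNeutrix_neutrix.sum_mem _ fun j _ =>
      mem_feasibility.1 (hF j) i _ ((ExternalNumber.mem_carrier_iff (hP i j)).1 (ha j))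

/-- A flexible system has the same solution as its integrated systems. -/
theorem solutionSet_eq_integrated {A : Matrix (Fin m) (Fin n) (ExternalNumber R)}
    {B : Fin m → ExternalNumber R} {P : Matrix (Fin m) (Fin n) R} (hP : IsRepresentative A P) :
    solutionSet A B = solutionSet (toExternal (integratedMatrix A B P)) (integratedRHS A B) := by
  ext x
  rw [mem_solutionSet_iff hP, mem_solutionSet_toExternal, Fin.forall_fin_add]
  simp only [integratedMatrix_mulVec_castAdd, integratedMatrix_mulVec_natAdd, integratedRHS,
    Fin.append_left, Fin.append_right]
  refine and_congr_right fun _ => ?_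
  rw [show (∀ h, x (constraintIndex A B h) ∈ (constraint A B h).carrier) ↔
    ∀ j, feasibility A B j ≠ Set.univ → x j ∈ feasibility A B j from
      forall_constraintIndex (p := fun j => x j ∈ feasibility A B j)]
  refine forall_congr' fun j => ⟨fun h _ => h, fun h => ?_⟩
  by_cases hj : feasibility A B j = Set.univ
  · simp [hj]
  · exact h hj

theorem integratedRHS_neutrix_ne_univ {A : Matrix (Fin m) (Fin n) (ExternalNumber R)}
    {B : Fin m → ExternalNumber R} (hB : ∀ i, (B i).neutrix ≠ Set.univ) :
    ∀ i, (integratedRHS A B i).neutrix ≠ Set.univ := by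
  rw [Fin.forall_fin_add]
  simp only [integratedRHS, Fin.append_left, Fin.append_right, constraint_neutrix]
  exact ⟨hB, forall_constraintIndex.2 fun j hj => hj⟩

/-- The coefficients of an unconstrained variable are precise. -/
theorem eq_of_feasibility_eq_univ {A : Matrix (Fin m) (Fin n) (ExternalNumber R)}
    {B : Fin m → ExternalNumber R} (hB : ∀ i, (B i).neutrix ≠ Set.univ)
    {P P' : Matrix (Fin m) (Fin n) R} (hP : IsRepresentative A P) (hP' : IsRepresentative A P')
    {j : Fin n} (hj : feasibility A B j = Set.univ) (i : Fin m) : P i j = P' i j := by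
  by_contra hne
  -- A nonzero difference d of representatives lies in A_ij. As F_j = R, every x = (x / d) d would
  -- lie in B_i, so B_i would be R.
  refine hB i (Set.eq_univ_of_forall fun x => ?_)
  have h := mem_feasibility.1 (hj ▸ Set.mem_univ (x / (P i j - P' i j))) i _
    ((ExternalNumber.mem_carrier_iff (hP' i j)).1 (hP i j))
  rwa [div_mul_cancel₀ _ (sub_ne_zero.2 hne)] at h

/-- Both matrices have the same kernel: K makes the constrained coordinates vanish, and in the other
columns the representatives coincide. -/
theorem integratedMatrix_rank_eq {A : Matrix (Fin m) (Fin n) (ExternalNumber R)}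
    {B : Fin m → ExternalNumber R} (hB : ∀ i, (B i).neutrix ≠ Set.univ)
    {P P' : Matrix (Fin m) (Fin n) R} (hP : IsRepresentative A P) (hP' : IsRepresentative A P') :
    (integratedMatrix A B P).rank = (integratedMatrix A B P').rank := by
  refine Matrix.rank_eq_of_mulVec_eq_zero_iff fun x => ?_
  simp only [funext_iff, Fin.forall_fin_add, integratedMatrix_mulVec_castAdd,
    integratedMatrix_mulVec_natAdd, Pi.zero_apply]
  refine and_congr_left fun hK => forall_congr' fun i => ?_
  rw [forall_constraintIndex (p := fun j => x j = 0)] at hK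
  have : P.mulVec x i = P'.mulVec x i := by
    rw [Matrix.mulVec, Matrix.mulVec, dotProduct, dotProduct]
    refine Finset.sum_congr rfl fun j _ => ?_
    by_cases hj : feasibility A B j = Set.univ
    · rw [eq_of_feasibility_eq_univ hB hP hP' hj]
    · rw [hK j hj, mul_zero, mul_zero]
  rw [this]

end SolutionSets

/-! ### Gaussian elimination without loss of information. -/

section Elimination

variable {R : Type*} [Field R] [LinearOrder R] {n p q : ℕ}
  {P : Matrix (Fin p) (Fin n) R} {B : Fin p → ExternalNumber R} {σ : Equiv.Perm (Fin n)}
  {Q : Matrix (Fin p) (Fin n) R} {C : Fin p → ExternalNumber R}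

theorem hEquivalent_permMatrix_iff {A : Matrix (Fin q) (Fin n) (ExternalNumber R)}
    {B : Fin q → ExternalNumber R} {A' : Matrix (Fin p) (Fin n) (ExternalNumber R)}
    {B' : Fin p → ExternalNumber R} :
    HEquivalent (σ.permMatrix R) A B A' B' ↔
      ∀ x, x ∈ solutionSet A B ↔ x ∘ σ ∈ solutionSet A' B' := by
  simp [HEquivalent, Matrix.permMatrix_mulVec]

theorem GaussianElim.rank_eq (h : GaussianElim P B σ Q C) : Q.rank = P.rank := by
  induction h with
  | refl => rfl
  | @swapRows σ Q C i i' _ ih =>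
    rw [← ih]
    exact Q.rank_submatrix (Equiv.swap i i') (Equiv.refl _)
  | @scaleRow σ Q C i c hc _ ih =>
    rw [← ih]
    refine Matrix.rank_eq_of_mulVec_eq_zero_iff fun x => ?_
    simp only [Matrix.updateRow_mulVec, funext_iff]
    refine forall_congr' fun k => ?_
    rcases eq_or_ne k i with rfl | hk
    · simp [hc, Matrix.mulVec]
    · simp [hk]
  | @addRow σ Q C i i' hi c _ ih =>
    rw [← ih]
    refine Matrix.rank_eq_of_mulVec_eq_zero_iff fun x => ?_
    have hrow : ∀ k, (Q.updateRow i (Q i + c • Q i')).mulVec x k =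
        Function.update (Q.mulVec x) i (Q.mulVec x i + c * Q.mulVec x i') k := fun k => by
      rw [Matrix.updateRow_mulVec, add_dotProduct, smul_dotProduct]
      rfl
    simp only [funext_iff, hrow, Pi.zero_apply]
    constructor
    · intro h k
      have h' := h i'
      rw [Function.update_of_ne hi.symm] at h'
      rcases eq_or_ne k i with rfl | hk
      · simpa [h'] using h k
      · simpa [hk] using h k
    · intro h k
      rcases eq_or_ne k i with rfl | hk
      · simp [h]
      · simp [hk, h]
  | @swapCols σ Q C j j' _ ih =>
    rw [← ih]
    exact Q.rank_submatrix (Equiv.refl _) (Equiv.swap j j')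

/-- Valid for arbitrary elimination, lossless or not: scaling does not turn a proper neutrix into R,
and a sum is one of its two terms. -/
theorem GaussianElim.neutrix_ne_univ [IsStrictOrderedRing R] (h : GaussianElim P B σ Q C)
    (hB : ∀ i, (B i).neutrix ≠ Set.univ) : ∀ i, (C i).neutrix ≠ Set.univ := by
  induction h with
  | refl => exact hB
  | swapRows i i' _ ih => exact fun k => ih _
  | swapCols j j' _ ih => exact ih
  | scaleRow i c hc _ ih =>
    intro k
    rcases eq_or_ne k i with rfl | hk
    · rw [Function.update_self]
      exact ExternalNumber.neutrix_smul_ne_univ (ih k)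
    · rw [Function.update_of_ne hk]
      exact ih k
  | @addRow σ Q C i i' hi c _ ih =>
    intro k
    rcases eq_or_ne k i with rfl | hk
    · rw [Function.update_self]
      rcases ExternalNumber.neutrix_add_eq_or (C k) (c • C i') with h | h <;> rw [h]
      · exact ih k
      · exact ExternalNumber.neutrix_smul_ne_univ (ih i')
    · rw [Function.update_of_ne hk]
      exact ih k

/-- Gaussian elimination without loss of information on the solution. -/
def EquivElim (P : Matrix (Fin p) (Fin n) R) (B : Fin p → ExternalNumber R)
    (σ : Equiv.Perm (Fin n)) (Q : Matrix (Fin p) (Fin n) R) (C : Fin p → ExternalNumber R) :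
    Prop :=
  GaussianElim P B σ Q C ∧ HEquivalent (σ.permMatrix R) (toExternal P) B (toExternal Q) C

namespace EquivElim

theorem refl : EquivElim P B 1 P B :=
  ⟨.refl, hEquivalent_permMatrix_iff.2 fun _ => Iff.rfl⟩

theorem swapRows (h : EquivElim P B σ Q C) (i i' : Fin p) :
    EquivElim P B σ (Q.submatrix (Equiv.swap i i') id) (C ∘ Equiv.swap i i') := by
  refine ⟨h.1.swapRows i i', hEquivalent_permMatrix_iff.2 fun x => ?_⟩
  rw [hEquivalent_permMatrix_iff.1 h.2 x, mem_solutionSet_toExternal, mem_solutionSet_toExternal]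
  exact ((Equiv.swap i i').forall_congr_right
    (q := fun k => Q.mulVec (x ∘ σ) k ∈ (C k).carrier)).symm

theorem swapCols (h : EquivElim P B σ Q C) (j j' : Fin n) :
    EquivElim P B (σ * Equiv.swap j j') (Q.submatrix id (Equiv.swap j j')) C := by
  refine ⟨h.1.swapCols j j', hEquivalent_permMatrix_iff.2 fun x => ?_⟩
  rw [hEquivalent_permMatrix_iff.1 h.2 x, mem_solutionSet_toExternal, mem_solutionSet_toExternal,
    Matrix.submatrix_mulVec_equiv]
  have : (x ∘ ⇑(σ * Equiv.swap j j')) ∘ ⇑(Equiv.swap j j').symm = x ∘ σ := by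
    ext k; simp
  rw [this]
  rfl

theorem scaleRow (h : EquivElim P B σ Q C) (i : Fin p) {c : R} (hc : c ≠ 0) :
    EquivElim P B σ (Q.updateRow i (c • Q i)) (Function.update C i (c • C i)) := by
  refine ⟨h.1.scaleRow i c hc, hEquivalent_permMatrix_iff.2 fun x => ?_⟩
  rw [hEquivalent_permMatrix_iff.1 h.2 x, mem_solutionSet_toExternal, mem_solutionSet_toExternal]
  refine forall_congr' fun k => ?_
  rw [Matrix.updateRow_mulVec, smul_dotProduct]
  rcases eq_or_ne k i with rfl | hk
  · rw [Function.update_self, Function.update_self, ExternalNumber.mem_smul]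
    exact ⟨fun h => ⟨_, h, rfl⟩, fun ⟨a, ha, hak⟩ =>
      (mul_left_cancel₀ hc hak : a = Q.mulVec (x ∘ σ) k) ▸ ha⟩
  · rw [Function.update_of_ne hk, Function.update_of_ne hk]

/-- The new neutrix C_i + cC_i' is then no larger than C_i, so subtracting c times row i' again
recovers the original condition on row i. -/
theorem addRow (h : EquivElim P B σ Q C) {i i' : Fin p} (hi : i ≠ i') {c : R}
    (hc : ∀ x ∈ (C i').neutrix, c * x ∈ (C i).neutrix) :
    EquivElim P B σ (Q.updateRow i (Q i + c • Q i')) (Function.update C i (C i + c • C i')) := by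
  refine ⟨h.1.addRow i i' hi c, hEquivalent_permMatrix_iff.2 fun x => ?_⟩
  rw [hEquivalent_permMatrix_iff.1 h.2 x, mem_solutionSet_toExternal, mem_solutionSet_toExternal,
    Matrix.updateRow_mulVec, add_dotProduct, smul_dotProduct]
  set z := Q.mulVec (x ∘ σ)
  change _ ↔ ∀ k, Function.update z i (z i + c * z i') k ∈ _
  constructor
  · intro hz k
    rcases eq_or_ne k i with rfl | hk
    · rw [Function.update_self, Function.update_self]
      exact ExternalNumber.mem_add.2
        ⟨_, hz k, _, ExternalNumber.mem_smul.2 ⟨_, hz i', rfl⟩, rfl⟩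
    · rw [Function.update_of_ne hk, Function.update_of_ne hk]
      exact hz k
  · intro hz k
    have hz' := hz i'
    have hzi := hz i
    rw [Function.update_of_ne hi.symm, Function.update_of_ne hi.symm] at hz'
    rcases eq_or_ne k i with rfl | hk
    · rw [Function.update_self, Function.update_self] at hzi
      obtain ⟨a, ha, b, hb, hab⟩ := ExternalNumber.mem_add.1 hzi
      obtain ⟨b', hb', rfl⟩ := ExternalNumber.mem_smul.1 hb
      -- Both b' and z i' represent the i'-th component, so their difference is in its neutrix, and
      -- `hc` applies.
      rw [ExternalNumber.mem_carrier_iff ha,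
        show z k - a = c * (b' - z i') by linear_combination -hab]
      exact hc _ ((ExternalNumber.mem_carrier_iff hz').1 hb')
    · have := hz k
      rwa [Function.update_of_ne hk, Function.update_of_ne hk] at this

/-- Adding multiples of one row to several other rows. -/
theorem addRows (h : EquivElim P B σ Q C) (k : Fin p) (c : Fin p → R) (T : Finset (Fin p))
    (hk : k ∉ T) (hc : ∀ i ∈ T, ∀ x ∈ (C k).neutrix, c i * x ∈ (C i).neutrix) :
    ∃ Q' C', EquivElim P B σ Q' C' ∧ (∀ i ∈ T, Q' i = Q i + c i • Q k) ∧
      (∀ i ∉ T, Q' i = Q i) ∧ ∀ i, (C' i).neutrix = (C i).neutrix := by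
  classical
  induction T using Finset.induction_on with
  | empty => exact ⟨Q, C, h, by simp⟩
  | insert a T ha ih =>
    obtain ⟨Q', C', h', hT, hT', hC⟩ := ih (fun hkT => hk (Finset.mem_insert_of_mem hkT))
      fun i hi => hc i (Finset.mem_insert_of_mem hi)
    have hka : k ≠ a := fun e => hk (e ▸ Finset.mem_insert_self _ _)
    have hkT : k ∉ T := fun hkT => hk (Finset.mem_insert_of_mem hkT)
    have hca : ∀ x ∈ (C' k).neutrix, c a * x ∈ (C' a).neutrix := by
      rw [hC, hC]
      exact hc a (Finset.mem_insert_self _ _)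
    refine ⟨_, _, h'.addRow hka.symm hca, fun i hi => ?_, fun i hi => ?_, fun i => ?_⟩
    · rcases eq_or_ne i a with rfl | hia
      · rw [Matrix.updateRow_self, hT' i ha, hT' k hkT]
      · rw [Matrix.updateRow_ne hia, hT i ((Finset.mem_insert.1 hi).resolve_left hia)]
    · have hia : i ≠ a := fun e => hi (e ▸ Finset.mem_insert_self _ _)
      rw [Matrix.updateRow_ne hia, hT' i fun hiT => hi (Finset.mem_insert_of_mem hiT)]
    · rcases eq_or_ne i a with rfl | hia
      · rw [Function.update_self, ← hC]
        refine ExternalNumber.neutrix_add_of_subset fun x hx => ?_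
        obtain ⟨y, hy, rfl⟩ := ExternalNumber.mem_neutrix_smul.1 hx
        exact hca y hy
      · rw [Function.update_of_ne hia, hC]

end EquivElim

/-- The first `s` columns have been cleared below the diagonal, and the neutrix part of each of
the first `s` rows is dominated by the subsequent rows. -/
structure IsPartialEchelon (s : ℕ) (Q : Matrix (Fin p) (Fin n) R) (C : Fin p → ExternalNumber R) :
    Prop where
  diag : ∀ (i : Fin p) (j : Fin n), i.val = j.val → i.val < s → Q i j = 1
  lower : ∀ (i : Fin p) (j : Fin n), j.val < i.val → j.val < s → Q i j = 0
  abs_le : ∀ (i : Fin p) (j : Fin n), i.val < s → |Q i j| ≤ 1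
  dominated : ∀ (i i' : Fin p) (j : Fin n), i.val < s → i < i' →
    ∀ x ∈ (C i).neutrix, Q i' j * x ∈ (C i').neutrix

variable [IsStrictOrderedRing R]

/-- Normalise each remaining nonzero row by its entry of largest absolute value and take the row
whose normalised neutrix is smallest. For another such row with largest entry q, the normalised
pivot neutrix lies in q⁻¹C_i; multiplying by an entry of absolute value at most |q| lands in C_i. -/
theorem exists_pivot {s : ℕ} {i₁ : Fin p} (hi₁ : s ≤ i₁.val) (hQ : Q i₁ ≠ 0)
    (C : Fin p → ExternalNumber R) :
    ∃ i₀ : Fin p, ∃ j₀ : Fin n, s ≤ i₀.val ∧ Q i₀ j₀ ≠ 0 ∧ (∀ j, |Q i₀ j| ≤ |Q i₀ j₀|) ∧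
      ∀ i : Fin p, s ≤ i.val → ∀ j, ∀ x ∈ (C i₀).neutrix,
        Q i j * (Q i₀ j₀)⁻¹ * x ∈ (C i).neutrix := by
  classical
  obtain ⟨j₁, hj₁⟩ := Function.ne_iff.1 hQ
  have : Nonempty (Fin n) := ⟨j₁⟩
  choose J hJ using fun i => Finite.exists_max fun j => |Q i j|
  obtain ⟨i₀, hi₀, hmin⟩ := Finset.exists_minimalFor
    (fun i => ((Q i (J i))⁻¹ • C i).neutrix) {i : Fin p | s ≤ i.val ∧ Q i ≠ 0}
    ⟨i₁, by simp [hi₁, hQ]⟩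
  have hne : ∀ i, Q i ≠ 0 → Q i (J i) ≠ 0 := by
    intro i hi h0
    refine hi (funext fun j => ?_)
    simpa [h0] using hJ i j
  simp only [Finset.mem_filter, Finset.mem_univ, true_and] at hi₀ hmin
  refine ⟨i₀, J i₀, hi₀.1, hne _ hi₀.2, hJ i₀, fun i hi j x hx => ?_⟩
  by_cases hQi : Q i = 0
  · simpa [hQi] using (C i).isNeutrix_neutrix.zero_mem
  -- Minimality for inclusion is leastness, by total order.
  have hsub : ((Q i₀ (J i₀))⁻¹ • C i₀).neutrix ⊆ ((Q i (J i))⁻¹ • C i).neutrix :=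
    (ExternalNumber.isNeutrix_neutrix _).subset_total (ExternalNumber.isNeutrix_neutrix _)
      |>.elim id (hmin ⟨hi, hQi⟩)
  obtain ⟨a, ha, hax⟩ := ExternalNumber.mem_neutrix_smul.1
    (hsub (ExternalNumber.mem_neutrix_smul.2 ⟨x, hx, rfl⟩))
  have hq := hne i hQi
  rw [mul_assoc, ← hax]
  refine (C i).isNeutrix_neutrix.mul_mem_of_abs_le (hJ i j) ?_
  rwa [mul_inv_cancel_left₀ hq]

/-- Interchanges move the pivot to position (s, s), the pivot row is divided by it, and the column
below is cleared. By the choice of pivot the clearing changes no neutrix, and domination survives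
it. -/
theorem IsPartialEchelon.step {s : ℕ} (h : IsPartialEchelon s Q C) (hE : EquivElim P B σ Q C)
    {i₁ : Fin p} (hi₁ : s ≤ i₁.val) (hQ : Q i₁ ≠ 0) :
    s < n ∧ ∃ σ' Q' C', EquivElim P B σ' Q' C' ∧ IsPartialEchelon (s + 1) Q' C' := by
  obtain ⟨i₀, j₀, hi₀, hq, hmax, hdom⟩ := exists_pivot hi₁ hQ C
  -- The pivot is nonzero, whereas row i₀ already vanishes in the first s columns.
  have hj₀ : s ≤ j₀.val := by
    by_contra! hlt
    exact hq (h.lower i₀ j₀ (hlt.trans_le hi₀) hlt)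
  have hsn : s < n := hj₀.trans_lt j₀.2
  refine ⟨hsn, ?_⟩
  set a : Fin p := ⟨s, hi₀.trans_lt i₀.2⟩ with ha
  set b : Fin n := ⟨s, hsn⟩ with hb
  set e := Equiv.swap i₀ a with he
  set f := Equiv.swap j₀ b with hf
  have he_lt : ∀ i : Fin p, i.val < s → e i = i := fun i hi =>
    Equiv.swap_apply_of_ne_of_ne (by rintro rfl; omega) (by rintro rfl; simp [ha] at hi)
  have hf_lt : ∀ j : Fin n, j.val < s → f j = j := fun j hj =>
    Equiv.swap_apply_of_ne_of_ne (by rintro rfl; omega) (by rintro rfl; simp [hb] at hj)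
  have he_le : ∀ i : Fin p, s ≤ i.val → s ≤ (e i).val := fun i hi => by
    by_contra! hlt
    have := he_lt _ hlt
    rw [EmbeddingLike.apply_eq_iff_eq] at this
    rw [this] at hlt
    omega
  have hea : e a = i₀ := Equiv.swap_apply_right _ _
  have hfb : f b = j₀ := Equiv.swap_apply_right _ _
  have hq' : (Q i₀ j₀)⁻¹ ≠ 0 := inv_ne_zero hq
  have hE₂ := ((hE.swapRows i₀ a).swapCols j₀ b).scaleRow a hq'
  set Q₂ : Matrix (Fin p) (Fin n) R := Matrix.updateRow _ a _ with hQ₂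
  set C₂ : Fin p → ExternalNumber R := Function.update _ a _ with hC₂
  have hQa : ∀ j, Q₂ a j = (Q i₀ j₀)⁻¹ * Q i₀ (f j) := fun j => by
    rw [hQ₂, Matrix.updateRow_self]
    change (Q i₀ j₀)⁻¹ * Q (e a) (f j) = _
    rw [hea]
  have hQne : ∀ i, i ≠ a → ∀ j, Q₂ i j = Q (e i) (f j) := fun i hi j => by
    rw [hQ₂, Matrix.updateRow_ne hi]
    rfl
  have hCa : ∀ x, x ∈ (C₂ a).neutrix ↔ ∃ y ∈ (C i₀).neutrix, (Q i₀ j₀)⁻¹ * y = x := fun x => by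
    rw [hC₂, Function.update_self, ExternalNumber.mem_neutrix_smul]
    change (∃ y ∈ (C (e a)).neutrix, _) ↔ _
    rw [hea]
  have hCne : ∀ i, i ≠ a → C₂ i = C (e i) := fun i hi => by
    rw [hC₂, Function.update_of_ne hi]
    rfl
  have hne_lt : ∀ i : Fin p, i.val < s → i ≠ a := by rintro _ hi rfl; simp [ha] at hi
  have hne_gt : ∀ i : Fin p, s < i.val → i ≠ a := by rintro _ hi rfl; simp [ha] at hi
  have hlt : ∀ (i : Fin p) (j : Fin n), i.val < s → Q₂ i j = Q i (f j) := fun i j hi => by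
    rw [hQne i (hne_lt i hi), he_lt i hi]
  have hCalt : ∀ i : Fin p, i.val < s → C₂ i = C i := fun i hi => by
    rw [hCne i (hne_lt i hi), he_lt i hi]
  have habs : ∀ j, |Q₂ a j| ≤ 1 := fun j => by
    rw [hQa, abs_mul, abs_inv, inv_mul_le_iff₀ (abs_pos.2 hq), mul_one]
    exact hmax _
  have hlow : ∀ (i : Fin p) (j : Fin n), s ≤ i.val → j.val < s → Q₂ i j = 0 := by
    intro i j hi hj
    rcases eq_or_ne i a with rfl | hia
    · rw [hQa, hf_lt j hj, h.lower i₀ j (hj.trans_le hi₀) hj, mul_zero]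
    · rw [hQne i hia, hf_lt j hj, h.lower _ j (hj.trans_le (he_le i hi)) hj]
  -- Domination before clearing, now including the pivot row s itself.
  have hdom₂ : ∀ (i i' : Fin p) (j : Fin n), i.val ≤ s → i < i' →
      ∀ x ∈ (C₂ i).neutrix, Q₂ i' j * x ∈ (C₂ i').neutrix := by
    intro i i' j hi hii' x hx
    rcases hi.lt_or_eq with his | his
    · rw [hCalt i his] at hx
      rcases eq_or_ne i' a with rfl | hia
      -- Coefficients and neutrix of the pivot row were divided by the same pivot, so the former
      -- inclusion is just rescaled.
      · rw [hQa, hCa]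
        exact ⟨_, h.dominated i i₀ (f j) his (Fin.lt_def.2 (his.trans_le hi₀)) x hx, by ring⟩
      · rw [hQne i' hia, hCne i' hia]
        refine h.dominated i (e i') (f j) his ?_ x hx
        by_contra! hlt'
        have h1 := he_lt (e i') (lt_of_le_of_lt (Fin.le_def.1 hlt') his)
        rw [EmbeddingLike.apply_eq_iff_eq] at h1
        rw [h1] at hlt'
        exact absurd hii' (not_lt.2 hlt')
    · obtain rfl : i = a := Fin.ext his
      have hi' : i' ≠ a := hii'.ne'
      obtain ⟨y, hy, rfl⟩ := (hCa x).1 hx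
      rw [hQne i' hi', hCne i' hi', ← mul_assoc]
      exact hdom (e i') (he_le _ (Fin.lt_def.1 hii').le) _ y hy
  have hT : a ∉ ({i | a < i} : Finset (Fin p)) := by simp
  obtain ⟨Q₃, C₃, hE₃, hgt, hle, hC₃⟩ := hE₂.addRows a (fun i => -Q₂ i b) {i | a < i} hT
    fun i hi x hx => by
      rw [neg_mul]
      exact (C₂ i).isNeutrix_neutrix.neg_mem
        (hdom₂ a i b le_rfl (by simpa using hi) x hx)
  have hgt' : ∀ i : Fin p, s < i.val → ∀ j, Q₃ i j = Q₂ i j - Q₂ i b * Q₂ a j := fun i hi j => by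
    rw [hgt i (by simpa [Fin.lt_def, ha] using hi)]
    simp [sub_eq_add_neg]
  have hle' : ∀ i : Fin p, i.val ≤ s → Q₃ i = Q₂ i := fun i hi =>
    hle i (by simpa [Fin.le_def, ha] using hi)
  have hab : Q₂ a b = 1 := by rw [hQa, hfb, inv_mul_cancel₀ hq]
  refine ⟨_, Q₃, C₃, hE₃, ?_, ?_, ?_, ?_⟩
  · intro i j hij hi
    rw [hle' i (by omega)]
    rcases (Nat.lt_succ_iff_lt_or_eq.1 hi) with his | his
    · rw [hlt i j his, hf_lt j (by omega), h.diag i j hij his]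
    · obtain rfl : i = a := Fin.ext his
      obtain rfl : j = b := Fin.ext (hij.symm.trans his)
      exact hab
  · intro i j hji hj
    rcases le_or_gt i.val s with his | his
    · rw [hle' i his]
      rcases his.lt_or_eq with his' | his'
      · rw [hlt i j his', hf_lt j (by omega), h.lower i j hji (by omega)]
      · exact hlow i j his'.ge (by omega)
    · rw [hgt' i his]
      rcases (Nat.lt_succ_iff_lt_or_eq.1 hj) with hjs | hjs
      · rw [hlow i j his.le hjs, hlow a j le_rfl hjs, mul_zero, sub_zero]
      · obtain rfl : j = b := Fin.ext hjs
        rw [hab, mul_one, sub_self]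
  · intro i j hi
    rw [hle' i (by omega)]
    rcases (Nat.lt_succ_iff_lt_or_eq.1 hi) with his | his
    · rw [hlt i j his]
      exact h.abs_le i _ his
    · obtain rfl : i = a := Fin.ext his
      exact habs j
  · intro i i' j hi hii' x hx
    rw [hC₃] at hx ⊢
    rcases le_or_gt i'.val s with his | his
    · rw [hle' i' his]
      exact hdom₂ i i' j (by omega) hii' x hx
    · rw [hgt' i' his, sub_mul, mul_assoc]
      -- The cleared entry is Q i' j - Q i' b · Q a j. Since |Q a j| ≤ 1, the factor Q a j keeps x
      -- in the neutrix of row i, and both terms are then dominated.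
      refine (C₂ i').isNeutrix_neutrix.sub_mem (hdom₂ i i' j (by omega) hii' x hx)
        (hdom₂ i i' b (by omega) hii' _ ?_)
      exact (C₂ i).isNeutrix_neutrix.smul_mem (habs j) hx

theorem IsPartialEchelon.exists_complete {s : ℕ} (hsp : s ≤ p) (hsn : s ≤ n)
    (h : IsPartialEchelon s Q C) (hE : EquivElim P B σ Q C) :
    ∃ s ≤ p, s ≤ n ∧ ∃ σ' Q' C', EquivElim P B σ' Q' C' ∧ IsPartialEchelon s Q' C' ∧
      ∀ i : Fin p, s ≤ i.val → Q' i = 0 := by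
  induction hd : p - s generalizing s σ Q C with
  | zero => exact ⟨s, hsp, hsn, σ, Q, C, hE, h, fun i hi => by omega⟩
  | succ d ih =>
    by_cases hz : ∀ i : Fin p, s ≤ i.val → Q i = 0
    · exact ⟨s, hsp, hsn, σ, Q, C, hE, h, hz⟩
    · push Not at hz
      obtain ⟨i₁, hi₁, hQ⟩ := hz
      obtain ⟨hlt, σ', Q', C', hE', h'⟩ := h.step hE hi₁ hQ
      exact ih (by omega) hlt h' hE' (by omega)

/-- At most s rows are nonzero, and the leading s × s block is unitriangular, hence of rank s. -/
theorem IsPartialEchelon.rank_eq {s : ℕ} (hsp : s ≤ p) (hsn : s ≤ n) (h : IsPartialEchelon s Q C)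
    (hz : ∀ i : Fin p, s ≤ i.val → Q i = 0) : Q.rank = s := by
  refine le_antisymm ?_ ?_
  · refine (Q.rank_le_card_of_support_subset {i | i.val < s} ?_).trans ?_
    · intro i hi
      by_contra hi'
      simp only [Finset.coe_filter, Finset.mem_univ, true_and, Set.mem_ofPred_eq, not_lt] at hi'
      exact hi (hz i hi')
    · have := Finset.card_le_card_of_injOn (s := {i : Fin p | i.val < s}) (t := Finset.range s)
        (fun i => i.val) (fun i hi => by simpa using hi) (fun i _ j _ hij => Fin.ext hij)
      simpa using this
  · set U := Q.submatrix (Fin.castLE hsp) (Fin.castLE hsn) with hU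
    have hdet : U.det = 1 := by
      rw [Matrix.det_of_isUpperTriangular (M := U) fun i j hij => h.lower _ _ (by simpa using hij)
        (by simp)]
      exact Finset.prod_eq_one fun i _ => h.diag _ _ rfl (by simp)
    have hrank := Matrix.rank_of_isUnit U ((Matrix.isUnit_iff_isUnit_det U).2 (by simp [hdet]))
    rw [Fintype.card_fin] at hrank
    rw [← hrank]
    exact Q.rank_submatrix_le _ _

theorem exists_equivElim_isIncreasingRowEchelon (P : Matrix (Fin p) (Fin n) R)
    (B : Fin p → ExternalNumber R) (hP : 1 ≤ P.rank) :
    ∃ σ Q C, EquivElim P B σ Q C ∧ IsIncreasingRowEchelon Q C := by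
  have h0 : IsPartialEchelon 0 P B := ⟨by simp, by simp, by simp, by simp⟩
  obtain ⟨s, hsp, hsn, σ, Q, C, hE, h, hz⟩ :=
    h0.exists_complete (Nat.zero_le _) (Nat.zero_le _) EquivElim.refl
  have hr : Q.rank = s := h.rank_eq hsp hsn hz
  have hs : 1 ≤ s := by rwa [← hr, hE.1.rank_eq]
  refine ⟨σ, Q, C, hE, hr ▸ hs, ?_, fun i j hi hj => h.diag i j (hi.trans hj.symm) (by omega),
    ?_, ?_, ?_⟩
  · intro i i' hii' j hj
    rcases lt_or_ge i'.val s with hi' | hi'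
    · have hi : i.val < s := (Fin.lt_def.1 hii').trans hi'
      -- Row i has a 1 in column i, so it can vanish to the left of j only if j ≤ i; then j < i' and
      -- j < s.
      refine h.lower i' j ?_ ?_ <;>
      · by_contra! hle
        have := hj ⟨i.val, hi.trans_le hsn⟩ (Fin.lt_def.2 (by simp; omega))
        rw [h.diag i _ rfl hi] at this
        exact one_ne_zero this
    · rw [hz i' hi']
      rfl
  · intro i j
    rcases lt_or_ge i.val s with hi | hi
    · exact h.abs_le i j hi
    · simp [hz i hi]
  · intro i j hij
    rw [hr]
    rcases lt_or_ge i.val s with hi | hi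
    · simp [h.diag i j hij hi, hi]
    · simp [hz i hi, hi]
  · intro i i' hii' hi' x hx
    rw [hr] at hi'
    rcases hii'.lt_or_eq with hlt | rfl
    · have := h.dominated i i' ⟨i'.val, hi'.trans_le hsn⟩ ((Fin.lt_def.1 hlt).trans hi') hlt x hx
      rwa [h.diag i' _ rfl hi', one_mul] at this
    · exact hx

end Elimination

/-! ### The solution of a system in increasing row-echelon form. -/

section ClosedForm

variable {R : Type*} [Field R] {n p r : ℕ}

/-- Induction on the column: the row with index j vanishes to the left of column j, so the echelon
condition makes column j vanish in all later rows. -/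
theorem Matrix.IsRowEchelon.eq_zero_of_val_lt {Q : Matrix (Fin p) (Fin n) R}
    (h : Q.IsRowEchelon) {i : Fin p} {j : Fin n} (hij : j.val < i.val) : Q i j = 0 := by
  induction hj : j.val using Nat.strong_induction_on generalizing i j with
  | _ k ih =>
    subst hj
    refine h (i₁ := ⟨j.val, hij.trans i.2⟩) (Fin.lt_def.2 hij) fun j₁ hj₁ => ?_
    exact ih j₁.val hj₁ (Fin.lt_def.1 hj₁) rfl

theorem dotProduct_extendZero (hr : r ≤ n) (w : Fin n → R) (v : Fin r → R) :
    w ⬝ᵥ extendZero n v = ∑ j, w (Fin.castLE hr j) * v j := by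
  obtain ⟨s, rfl⟩ := Nat.exists_eq_add_of_le hr
  rw [dotProduct, Fin.sum_univ_add]
  simp [extendZero, Fin.castLE]
  rfl

theorem extendZero_add (v w : Fin r → R) :
    extendZero n (v + w) = extendZero n v + extendZero n w := by
  ext l
  by_cases hl : l.val < r <;> simp [extendZero, hl]

theorem extendZero_smul (t : R) (v : Fin r → R) :
    extendZero n (t • v) = t • extendZero n v := by
  ext l
  by_cases hl : l.val < r <;> simp [extendZero, hl]

/-- The linear map `v ↦ ((Q^(r))⁻¹ v, 0)`. -/
noncomputable def supportMap (Q : Matrix (Fin p) (Fin n) R) :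
    (Fin Q.rank → R) →ₗ[R] (Fin n → R) where
  toFun v := extendZero n ((leadingBlock Q)⁻¹.mulVec v)
  map_add' v w := by rw [Matrix.mulVec_add, extendZero_add]
  map_smul' t v := by rw [Matrix.mulVec_smul, extendZero_smul]; rfl

theorem supportMap_apply (Q : Matrix (Fin p) (Fin n) R) (v : Fin Q.rank → R) :
    supportMap Q v = extendZero n ((leadingBlock Q)⁻¹.mulVec v) := rfl

theorem kernelVector_eq (Q : Matrix (Fin p) (Fin n) R) {k : Fin n} (hk : Q.rank ≤ k.val) :
    kernelVector Q k = Pi.single k 1 - supportMap Q (leadingPart Q fun i => Q i k) := by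
  ext l
  by_cases hl : l.val < Q.rank
  · have : l ≠ k := by rintro rfl; omega
    simp [kernelVector, supportMap_apply, extendZero, hl, this]
  · simp [kernelVector, supportMap_apply, extendZero, hl, Pi.single_apply]

theorem leadingRows_mulVec_extendZero (Q : Matrix (Fin p) (Fin n) R) (v : Fin Q.rank → R) :
    (leadingRows Q).mulVec (extendZero n v) = (leadingBlock Q).mulVec v := by
  ext i
  rw [Matrix.mulVec, dotProduct_extendZero Q.rank_le_width]
  rfl

variable [LinearOrder R] {Q : Matrix (Fin p) (Fin n) R} {C : Fin p → ExternalNumber R}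

namespace IsIncreasingRowEchelon

theorem leadingBlock_blockTriangular (h : IsIncreasingRowEchelon Q C) :
    (leadingBlock Q).BlockTriangular id := fun i j hij =>
  h.isRowEchelon.eq_zero_of_val_lt (by simpa using hij)

theorem det_leadingBlock (h : IsIncreasingRowEchelon Q C) : (leadingBlock Q).det = 1 := by
  rw [Matrix.det_of_isUpperTriangular (M := leadingBlock Q) h.leadingBlock_blockTriangular]
  exact Finset.prod_eq_one fun i _ => (h.diag_eq_one_iff _ _ rfl).2 i.2

theorem isUnit_det_leadingBlock (h : IsIncreasingRowEchelon Q C) :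
    IsUnit (leadingBlock Q).det := by
  rw [h.det_leadingBlock]
  exact isUnit_one

theorem leadingBlock_inv_blockTriangular (h : IsIncreasingRowEchelon Q C) :
    (leadingBlock Q)⁻¹.BlockTriangular id := by
  have := (leadingBlock Q).invertibleOfIsUnitDet h.isUnit_det_leadingBlock
  exact Matrix.blockTriangular_inv_of_blockTriangular h.leadingBlock_blockTriangular

theorem leadingRows_supportMap (h : IsIncreasingRowEchelon Q C) (v : Fin Q.rank → R) :
    (leadingRows Q).mulVec (supportMap Q v) = v := by
  rw [supportMap_apply, leadingRows_mulVec_extendZero, Matrix.mulVec_mulVec,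
    Matrix.mul_nonsing_inv _ h.isUnit_det_leadingBlock, Matrix.one_mulVec]

theorem supportMap_injective (h : IsIncreasingRowEchelon Q C) :
    Function.Injective (supportMap Q) :=
  Function.LeftInverse.injective h.leadingRows_supportMap

theorem leadingRows_kernelVector (h : IsIncreasingRowEchelon Q C) {k : Fin n}
    (hk : Q.rank ≤ k.val) : (leadingRows Q).mulVec (kernelVector Q k) = 0 := by
  rw [kernelVector_eq Q hk, Matrix.mulVec_sub, h.leadingRows_supportMap, Matrix.mulVec_single_one,
    sub_eq_zero]
  rfl

/-- Subtracting the kernel vectors weighted by the free coordinates of y makes these coordinates 0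
and leaves the leading rows' values unchanged. What is left has only its first r coordinates, which
the invertible leading block determines. -/
theorem eq_supportMap_add_sum (h : IsIncreasingRowEchelon Q C) (y : Fin n → R) :
    y = supportMap Q ((leadingRows Q).mulVec y) +
      ∑ k : Fin n with Q.rank ≤ k.val, y k • kernelVector Q k := by
  set s := ∑ k : Fin n with Q.rank ≤ k.val, y k • kernelVector Q k with hs
  have hs0 : (leadingRows Q).mulVec s = 0 := by
    rw [hs, Matrix.mulVec_sum]
    refine Finset.sum_eq_zero fun k hk => ?_
    rw [Matrix.mulVec_smul, h.leadingRows_kernelVector (by simpa using hk), smul_zero]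
  have hsl : ∀ l : Fin n, Q.rank ≤ l.val → s l = y l := by
    intro l hl
    rw [hs, Finset.sum_apply, Finset.sum_eq_single l]
    · simp [kernelVector, hl.not_gt]
    · intro k _ hk
      simp [kernelVector, hl.not_gt, hk.symm]
    · intro hl'
      exact absurd (by simpa using hl) hl'
  have hz : y - s = extendZero n fun i : Fin Q.rank => (y - s) (Fin.castLE Q.rank_le_width i) := by
    ext l
    by_cases hl : l.val < Q.rank
    · simp [extendZero, hl]
    · simp [extendZero, hl, hsl l (not_lt.1 hl)]
  have hy : (leadingRows Q).mulVec y = (leadingRows Q).mulVec (y - s) := by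
    rw [Matrix.mulVec_sub, hs0, sub_zero]
  rw [hy, ← sub_eq_iff_eq_add, supportMap_apply, hz, leadingRows_mulVec_extendZero,
    Matrix.mulVec_mulVec, Matrix.nonsing_inv_mul _ h.isUnit_det_leadingBlock, Matrix.one_mulVec]

theorem leadingRows_range (h : IsIncreasingRowEchelon Q C) :
    LinearMap.range (leadingRows Q).mulVecLin = ⊤ :=
  LinearMap.range_eq_top.2 fun v => ⟨supportMap Q v, h.leadingRows_supportMap v⟩

theorem finrank_ker_leadingRows (h : IsIncreasingRowEchelon Q C) :
    Module.finrank R (LinearMap.ker (leadingRows Q).mulVecLin) = n - Q.rank := by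
  have := (leadingRows Q).mulVecLin.finrank_range_add_finrank_ker
  rw [h.leadingRows_range, finrank_top] at this
  simp only [Module.finrank_fintype_fun_eq_card, Fintype.card_fin] at this
  omega

/-- The kernel of `Q` is contained in that of its leading rows, and both have dimension n - r. -/
theorem mulVec_eq_zero_of_leadingRows (h : IsIncreasingRowEchelon Q C) {y : Fin n → R}
    (hy : (leadingRows Q).mulVec y = 0) : Q.mulVec y = 0 := by
  have hle : LinearMap.ker Q.mulVecLin ≤ LinearMap.ker (leadingRows Q).mulVecLin := by
    intro x hx
    rw [LinearMap.mem_ker, Matrix.mulVecLin_apply] at hx ⊢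
    ext i
    exact congrFun hx (Fin.castLE Q.rank_le_height i)
  have hfin : Module.finrank R (LinearMap.ker Q.mulVecLin) = n - Q.rank := by
    have := Q.mulVecLin.finrank_range_add_finrank_ker
    simp only [Module.finrank_fintype_fun_eq_card, Fintype.card_fin] at this
    rw [Matrix.rank]
    omega
  have heq := Submodule.eq_of_le_of_finrank_eq hle (hfin.trans h.finrank_ker_leadingRows.symm)
  have : y ∈ LinearMap.ker Q.mulVecLin := heq ▸ LinearMap.mem_ker.2 hy
  exact LinearMap.mem_ker.1 this

theorem mulVec_supportMap_eq_zero (h : IsIncreasingRowEchelon Q C) {i : Fin p}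
    (hi : Q.rank ≤ i.val) (v : Fin Q.rank → R) : Q.mulVec (supportMap Q v) i = 0 := by
  rw [supportMap_apply, Matrix.mulVec, dotProduct_extendZero Q.rank_le_width]
  refine Finset.sum_eq_zero fun j _ => ?_
  rw [h.isRowEchelon.eq_zero_of_val_lt (by simp; omega), zero_mul]

/-- The definition of the form only says that the diagonal entries after the r-th differ from 1.
That these rows vanish follows from the rank: modulo the kernel of the leading rows, y is supported
on the first r coordinates, where the echelon shape gives zeros. -/
theorem mulVec_eq_zero (h : IsIncreasingRowEchelon Q C) {i : Fin p} (hi : Q.rank ≤ i.val)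
    (y : Fin n → R) : Q.mulVec y i = 0 := by
  have hy := h.eq_supportMap_add_sum y
  have h0 : (leadingRows Q).mulVec (y - supportMap Q ((leadingRows Q).mulVec y)) = 0 := by
    rw [Matrix.mulVec_sub, h.leadingRows_supportMap, sub_self]
  have := congrFun (h.mulVec_eq_zero_of_leadingRows h0) i
  rwa [Matrix.mulVec_sub, Pi.sub_apply, h.mulVec_supportMap_eq_zero hi, sub_zero] at this

theorem mem_linearSum (h : IsIncreasingRowEchelon Q C) {y : Fin n → R} :
    y ∈ linearSum Q ↔ (leadingRows Q).mulVec y = 0 := by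
  rw [linearSum, Set.mem_finsetSum]
  constructor
  · rintro ⟨g, hg, rfl⟩
    rw [Matrix.mulVec_sum]
    refine Finset.sum_eq_zero fun k hk => ?_
    obtain ⟨t, -, v, rfl, hv⟩ := hg hk
    rw [← hv]
    change (leadingRows Q).mulVec (t • kernelVector Q k) = 0
    rw [Matrix.mulVec_smul, h.leadingRows_kernelVector (by simpa using hk), smul_zero]
  · intro hy
    refine ⟨fun k => y k • kernelVector Q k, fun {k} _ => ⟨y k, trivial, _, rfl, rfl⟩, ?_⟩
    have := h.eq_supportMap_add_sum y
    rw [hy, map_zero, zero_add] at this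
    exact this.symm

theorem mem_modularSum {y : Fin n → R} :
    y ∈ modularSum Q C ↔
      ∃ u, (∀ i, u i ∈ (leadingPart Q C i).neutrix) ∧ supportMap Q u = y := by
  have hsum : ∀ u : Fin Q.rank → R,
      supportMap Q u = ∑ i, u i • supportMap Q (Pi.single i 1) := fun u => by
    conv_lhs => rw [pi_eq_sum_univ' u, map_sum]
    simp only [map_smul]
  rw [modularSum, Set.mem_fintype_sum]
  constructor
  · rintro ⟨g, hg, rfl⟩
    choose u hu v hv huv using fun i => @hg i
    refine ⟨u, hu, ?_⟩
    rw [hsum]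
    refine Finset.sum_congr rfl fun i _ => ?_
    rw [← huv i, hv i]
    rfl
  · rintro ⟨u, hu, rfl⟩
    exact ⟨fun i => u i • supportMap Q (Pi.single i 1), fun {i} => ⟨u i, hu i, _, rfl, rfl⟩,
      (hsum u).symm⟩

/-- Recasts the last two terms of the formula as a preimage under the leading rows; neutrix
properties can then be checked coordinatewise. -/
theorem mem_modularSum_add_linearSum (h : IsIncreasingRowEchelon Q C) {y : Fin n → R} :
    y ∈ modularSum Q C + linearSum Q ↔
      ∀ i, (leadingRows Q).mulVec y i ∈ (leadingPart Q C i).neutrix := by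
  simp only [Set.mem_add, h.mem_linearSum, mem_modularSum]
  constructor
  · rintro ⟨_, ⟨u, hu, rfl⟩, z, hz, rfl⟩ i
    rw [Matrix.mulVec_add, h.leadingRows_supportMap, hz, add_zero]
    exact hu i
  · intro hy
    refine ⟨_, ⟨_, hy, rfl⟩, y - supportMap Q ((leadingRows Q).mulVec y), ?_, add_sub_cancel _ _⟩
    rw [Matrix.mulVec_sub, h.leadingRows_supportMap, sub_self]

theorem mem_solutionSet_iff (h : IsIncreasingRowEchelon Q C) {y : Fin n → R} :
    y ∈ solutionSet (toExternal Q) C ↔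
      y ∈ solutionSet (toExternal (leadingRows Q)) (leadingPart Q C) ∧
        ∀ i : Fin p, Q.rank ≤ i.val → (C i).IsNeutricial := by
  simp only [mem_solutionSet_toExternal, ExternalNumber.isNeutricial_iff]
  constructor
  · exact fun hy => ⟨fun i => hy _, fun i hi => h.mulVec_eq_zero hi y ▸ hy i⟩
  · rintro ⟨hy, hC⟩ i
    rcases lt_or_ge i.val Q.rank with hi | hi
    · exact hy ⟨i.val, hi⟩
    · rw [h.mulVec_eq_zero hi]
      exact hC i hi

theorem supportMap_mem_solutionSet (h : IsIncreasingRowEchelon Q C) {z : Fin Q.rank → R}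
    (hz : ∀ i, z i ∈ (leadingPart Q C i).carrier) :
    supportMap Q z ∈ solutionSet (toExternal (leadingRows Q)) (leadingPart Q C) := by
  rw [mem_solutionSet_toExternal, h.leadingRows_supportMap]
  exact hz

theorem solutionSet_nonempty_iff (h : IsIncreasingRowEchelon Q C) :
    (solutionSet (toExternal Q) C).Nonempty ↔
      ∀ i : Fin p, Q.rank ≤ i.val → (C i).IsNeutricial := by
  refine ⟨fun ⟨y, hy⟩ => (h.mem_solutionSet_iff.1 hy).2, fun hC => ?_⟩
  choose c hc using fun i => (leadingPart Q C i).nonempty_carrier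
  exact ⟨_, h.mem_solutionSet_iff.2 ⟨h.supportMap_mem_solutionSet hc, hC⟩⟩

theorem solutionSet_eq_leadingRows (h : IsIncreasingRowEchelon Q C)
    (hC : ∀ i : Fin p, Q.rank ≤ i.val → (C i).IsNeutricial) :
    solutionSet (toExternal Q) C = solutionSet (toExternal (leadingRows Q)) (leadingPart Q C) := by
  ext y
  rw [h.mem_solutionSet_iff, and_iff_left hC]

theorem isExact_leadingRows (h : IsIncreasingRowEchelon Q C) :
    IsExact (toExternal (leadingRows Q)) (leadingPart Q C) := by
  ext z
  simp only [Set.mem_ofPred_eq, rowApply_toExternal, Set.mem_singleton_iff]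
  constructor
  · rintro ⟨x, hx, hz⟩ i
    rw [hz]
    exact mem_solutionSet_toExternal.1 hx i
  · intro hz
    exact ⟨_, h.supportMap_mem_solutionSet hz, fun i => by rw [h.leadingRows_supportMap]⟩

theorem isExact_iff (h : IsIncreasingRowEchelon Q C) :
    IsExact (toExternal Q) C ↔ ∀ i : Fin p, Q.rank ≤ i.val → (C i).carrier = {0} := by
  rw [IsExact, Set.ext_iff]
  simp only [Set.mem_ofPred_eq, rowApply_toExternal, Set.mem_singleton_iff]
  constructor
  · intro hex i hi
    refine (C i).nonempty_carrier.subset_singleton_iff.1 fun w hw => ?_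
    choose c hc using fun i => (C i).nonempty_carrier
    -- Exactness attains a right-hand side with the arbitrary w in place i, but row i of `Q` only
    -- takes the value 0.
    obtain ⟨x, -, hx⟩ := (hex (Function.update c i w)).2 fun k => by
      rcases eq_or_ne k i with rfl | hk
      · rwa [Function.update_self]
      · rw [Function.update_of_ne hk]
        exact hc k
    have := hx i
    rwa [Function.update_self, h.mulVec_eq_zero hi] at this
  · intro hC z
    constructor
    · rintro ⟨x, hx, hz⟩ i
      rw [hz]
      exact mem_solutionSet_toExternal.1 hx i
    · intro hz
      have hx := h.supportMap_mem_solutionSet (z := leadingPart Q z) fun i => hz _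
      refine ⟨_, h.mem_solutionSet_iff.2 ⟨hx, fun i hi => ?_⟩, fun i => ?_⟩
      · rw [ExternalNumber.isNeutricial_iff, hC i hi]
        rfl
      · rcases lt_or_ge i.val Q.rank with hi | hi
        · exact (congrFun (h.leadingRows_supportMap (leadingPart Q z)) ⟨i.val, hi⟩).symm
        · rw [h.mulVec_eq_zero hi]
          simpa [hC i hi] using hz i

theorem solutionSet_eq (h : IsIncreasingRowEchelon Q C)
    (hC : ∀ i : Fin p, Q.rank ≤ i.val → (C i).IsNeutricial) {c : Fin p → R}
    (hc : ∀ i, c i ∈ (C i).carrier) :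
    solutionSet (toExternal Q) C = {supportVector Q c} + (modularSum Q C + linearSum Q) := by
  have hs : supportVector Q c = supportMap Q (leadingPart Q c) := rfl
  ext y
  rw [h.solutionSet_eq_leadingRows hC, mem_solutionSet_toExternal, Set.singleton_add,
    Set.image_add_left, Set.mem_preimage, h.mem_modularSum_add_linearSum, neg_add_eq_sub,
    Matrix.mulVec_sub, hs, h.leadingRows_supportMap]
  exact forall_congr' fun i => ExternalNumber.mem_carrier_iff (hc _)

variable [IsStrictOrderedRing R]

theorem isNeutrix_modularSum (Q : Matrix (Fin p) (Fin n) R) (C : Fin p → ExternalNumber R) :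
    IsNeutrix R (modularSum Q C) := by
  refine IsNeutrix.of_mem ?_ ?_ ?_ <;> simp only [mem_modularSum]
  · exact ⟨0, fun i => ExternalNumber.isNeutrix_neutrix _ |>.zero_mem, map_zero _⟩
  · rintro _ ⟨u, hu, rfl⟩ _ ⟨v, hv, rfl⟩
    exact ⟨u + v, fun i => ExternalNumber.isNeutrix_neutrix _ |>.add_mem (hu i) (hv i),
      map_add _ _ _⟩
  · rintro t ht _ ⟨u, hu, rfl⟩
    exact ⟨t • u, fun i => ExternalNumber.isNeutrix_neutrix _ |>.smul_mem ht (hu i),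
      map_smul _ _ _⟩

theorem isNeutrix_modularSum_add_linearSum (h : IsIncreasingRowEchelon Q C) :
    IsNeutrix R (modularSum Q C + linearSum Q) := by
  refine IsNeutrix.of_mem ?_ ?_ ?_ <;> simp only [h.mem_modularSum_add_linearSum]
  · intro i
    rw [Matrix.mulVec_zero]
    exact (ExternalNumber.isNeutrix_neutrix _).zero_mem
  · intro x hx y hy i
    rw [Matrix.mulVec_add]
    exact (ExternalNumber.isNeutrix_neutrix _).add_mem (hx i) (hy i)
  · intro t ht x hx i
    rw [Matrix.mulVec_smul]
    exact (ExternalNumber.isNeutrix_neutrix _).smul_mem ht (hx i)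

theorem isExternalPoint_solutionSet (h : IsIncreasingRowEchelon Q C)
    (hC : ∀ i : Fin p, Q.rank ≤ i.val → (C i).IsNeutricial) :
    IsExternalPoint R (solutionSet (toExternal Q) C) := by
  choose c hc using fun i => (C i).nonempty_carrier
  exact ⟨_, _, h.isNeutrix_modularSum_add_linearSum, h.solutionSet_eq hC hc⟩

theorem neutrixPart_solutionSet (h : IsIncreasingRowEchelon Q C)
    (hC : ∀ i : Fin p, Q.rank ≤ i.val → (C i).IsNeutricial) :
    neutrixPart (solutionSet (toExternal Q) C) = modularSum Q C + linearSum Q := by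
  choose c hc using fun i => (C i).nonempty_carrier
  rw [h.solutionSet_eq hC hc, h.isNeutrix_modularSum_add_linearSum.neutrixPart_singleton_add]

/-- A subspace containing x contains all its multiples; if the i-th leading row were nonzero at x,
its values on them would fill R and force C_i = R. -/
theorem linearPart_solutionSet (h : IsIncreasingRowEchelon Q C)
    (hC : ∀ i : Fin p, Q.rank ≤ i.val → (C i).IsNeutricial)
    (hne : ∀ i, (C i).neutrix ≠ Set.univ) :
    linearPart R (solutionSet (toExternal Q) C) = linearSum Q := by
  ext x
  rw [linearPart, Set.mem_ofPred_eq, h.neutrixPart_solutionSet hC, h.mem_linearSum]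
  constructor
  · rintro ⟨S, hS, hx⟩
    ext i
    by_contra hxi
    refine hne (Fin.castLE Q.rank_le_height i) (Set.eq_univ_of_forall fun t => ?_)
    have := h.mem_modularSum_add_linearSum.1
      (hS (S.smul_mem (t / (leadingRows Q).mulVec x i) hx)) i
    rw [Matrix.mulVec_smul, Pi.smul_apply, smul_eq_mul, div_mul_cancel₀ _ hxi] at this
    exact this
  · intro hx
    refine ⟨LinearMap.ker (leadingRows Q).mulVecLin, fun y hy => ?_, hx⟩
    have hy' : (leadingRows Q).mulVec y = 0 := hy
    rw [h.mem_modularSum_add_linearSum, hy']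
    exact fun i => (ExternalNumber.isNeutrix_neutrix _).zero_mem

theorem isModularPart_modularSum (h : IsIncreasingRowEchelon Q C)
    (hC : ∀ i : Fin p, Q.rank ≤ i.val → (C i).IsNeutricial)
    (hne : ∀ i, (C i).neutrix ≠ Set.univ) :
    IsModularPart R (solutionSet (toExternal Q) C) (modularSum Q C) := by
  refine ⟨isNeutrix_modularSum Q C, ?_, ?_⟩
  · rw [h.linearPart_solutionSet hC hne, h.neutrixPart_solutionSet hC, add_comm]
  · rw [h.linearPart_solutionSet hC hne]
    ext y
    rw [Set.mem_inter_iff, h.mem_linearSum, mem_modularSum, Set.mem_singleton_iff]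
    constructor
    · rintro ⟨hy, u, -, rfl⟩
      rw [h.leadingRows_supportMap] at hy
      rw [hy, map_zero]
    · rintro rfl
      exact ⟨Matrix.mulVec_zero _, 0,
        fun i => ExternalNumber.isNeutrix_neutrix _ |>.zero_mem, map_zero _⟩

end IsIncreasingRowEchelon

end ClosedForm

/-! ### Dimension of neutrices and invariance under linear equivalences. -/

section Dimension

variable {R : Type*} [Field R] {V W : Type*} [AddCommGroup V] [Module R V]
  [AddCommGroup W] [Module R W]

/-- A basis of the span can be chosen inside N, so the maximal cardinality is a finrank and linear
algebra applies. -/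
theorem hasDim_finrank_span [Module.Finite R V] (N : Set V) :
    HasDim R N (Module.finrank R (Submodule.span R N)) := by
  classical
  constructor
  · obtain ⟨f, hf, -, hli⟩ := Submodule.exists_fun_fin_finrank_span_eq R N
    refine ⟨Finset.univ.image f, ?_, ?_, ?_⟩
    · simpa [Set.range_subset_iff] using hf
    · rw [Finset.coe_image, Finset.coe_univ, Set.image_univ]
      exact hli.linearIndepOn_id
    · rw [Finset.card_image_of_injective _ hli.injective, Finset.card_univ, Fintype.card_fin]
  · rintro _ ⟨z, hz, hli, rfl⟩
    rw [← finrank_span_finset_eq_card hli]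
    exact Submodule.finrank_mono (Submodule.span_mono hz)

theorem HasDim.unique {N : Set V} {d d' : ℕ} (h : HasDim R N d) (h' : HasDim R N d') : d = d' :=
  IsGreatest.unique h h'

theorem hasDim_submodule [Module.Finite R V] (L : Submodule R V) :
    HasDim R (L : Set V) (Module.finrank R L) := by
  simpa using hasDim_finrank_span (R := R) (L : Set V)

theorem LinearEquiv.neutrixPart_image (e : V ≃ₗ[R] W) (ξ : Set V) :
    neutrixPart (e '' ξ) = e '' neutrixPart ξ :=
  (Set.image_sub e).symm

theorem HasDim.image [Module.Finite R V] [Module.Finite R W] (e : V ≃ₗ[R] W) {N : Set V} {d : ℕ}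
    (h : HasDim R N d) : HasDim R (e '' N) d := by
  rw [h.unique (hasDim_finrank_span N), ← e.finrank_map_eq, ← LinearEquiv.coe_toLinearMap,
    Submodule.map_span]
  exact hasDim_finrank_span _

theorem LinearEquiv.linearPart_image (e : V ≃ₗ[R] W) (ξ : Set V) :
    linearPart R (e '' ξ) = e '' linearPart R ξ := by
  ext y
  simp only [linearPart, e.neutrixPart_image]
  constructor
  · rintro ⟨S, hS, hy⟩
    refine ⟨e.symm y, ⟨S.comap e.toLinearMap, fun x hx => ?_, by simpa using hy⟩,
      e.apply_symm_apply y⟩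
    obtain ⟨x', hx', hxx'⟩ := hS (show e x ∈ S from hx)
    rwa [← e.injective hxx']
  · rintro ⟨x, ⟨S, hS, hx⟩, rfl⟩
    refine ⟨S.map e.toLinearMap, ?_, ⟨x, hx, rfl⟩⟩
    rintro _ ⟨x', hx', rfl⟩
    exact ⟨x', hS hx', rfl⟩

variable [LinearOrder R] [IsStrictOrderedRing R]

theorem LinearEquiv.isNeutrix_image (e : V ≃ₗ[R] W) {N : Set V} (hN : IsNeutrix R N) :
    IsNeutrix R (e '' N) := by
  refine IsNeutrix.of_mem ⟨0, hN.zero_mem, map_zero e⟩ ?_ ?_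
  · rintro _ ⟨x, hx, rfl⟩ _ ⟨y, hy, rfl⟩
    exact ⟨x + y, hN.add_mem hx hy, map_add e x y⟩
  · rintro t ht _ ⟨x, hx, rfl⟩
    exact ⟨t • x, hN.smul_mem ht hx, map_smul e t x⟩

theorem LinearEquiv.isModularPart_image (e : V ≃ₗ[R] W) {ξ M : Set V}
    (h : IsModularPart R ξ M) : IsModularPart R (e '' ξ) (e '' M) := by
  refine ⟨e.isNeutrix_image h.1, ?_, ?_⟩
  · rw [e.linearPart_image, e.neutrixPart_image, ← Set.image_add, h.2.1]
  · rw [e.linearPart_image, ← Set.image_inter e.injective, h.2.2, Set.image_singleton, map_zero]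

/-- Any element of the linear span of a neutrix is a multiple of an element of the neutrix. -/
theorem IsNeutrix.exists_smul_of_mem_span {N : Set V} (hN : IsNeutrix R N) {x : V}
    (hx : x ∈ Submodule.span R N) : ∃ t : R, 0 < t ∧ t • x ∈ N := by
  induction hx using Submodule.span_induction with
  | mem x hx => exact ⟨1, one_pos, by rwa [one_smul]⟩
  | zero => exact ⟨1, one_pos, by rw [smul_zero]; exact hN.zero_mem⟩
  | add x y _ _ hx hy =>
    have key : ∀ {s t : R} {z : V}, 0 < s → s ≤ t → t • z ∈ N → s • z ∈ N := by
      intro s t z hs hst hz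
      have ht := hs.trans_le hst
      have := hN.smul_mem (t := s / t)
        (by rwa [abs_of_pos (div_pos hs ht), div_le_one ht]) hz
      rwa [smul_smul, div_mul_cancel₀ _ ht.ne'] at this
    obtain ⟨s, hs, hsx⟩ := hx
    obtain ⟨t, ht, hty⟩ := hy
    -- Decreasing a positive factor keeps the multiple in N, so the smaller factor serves both
    -- summands.
    refine ⟨min s t, lt_min hs ht, ?_⟩
    rw [smul_add]
    exact hN.add_mem (key (lt_min hs ht) (min_le_left _ _) hsx)
      (key (lt_min hs ht) (min_le_right _ _) hty)
  | smul a x _ hx =>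
    obtain ⟨t, ht, htx⟩ := hx
    rcases eq_or_ne a 0 with rfl | ha
    · exact ⟨1, one_pos, by simpa using hN.zero_mem⟩
    -- This turns a x into t x up to the sign a / |a|.
    · refine ⟨t / |a|, div_pos ht (abs_pos.2 ha), ?_⟩
      have := hN.smul_mem (t := a / |a|) (by simp [abs_div, ha]) htx
      rwa [smul_smul, div_mul_eq_mul_div, mul_comm a t, ← div_mul_eq_mul_div, ← smul_smul] at this

/-- The span of M still meets L trivially: a common element has a positive multiple in M, which also
lies in L and so is 0. -/
theorem finrank_span_add_finrank [Module.Finite R V] {N M : Set V} {L : Submodule R V}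
    (hM : IsNeutrix R M) (hadd : (L : Set V) + M = N) (hinf : (L : Set V) ∩ M = {0}) :
    Module.finrank R (Submodule.span R M) + Module.finrank R L =
      Module.finrank R (Submodule.span R N) := by
  have hsup : Submodule.span R M ⊔ L = Submodule.span R N := by
    apply le_antisymm
    · refine sup_le (Submodule.span_mono fun x hx => ?_) fun x hx => Submodule.subset_span ?_
      · rw [← hadd]
        exact ⟨0, L.zero_mem, x, hx, zero_add x⟩
      · rw [← hadd]
        exact ⟨x, hx, 0, hM.zero_mem, add_zero x⟩
    · rw [Submodule.span_le, ← hadd]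
      rintro _ ⟨x, hx, y, hy, rfl⟩
      exact add_mem (Submodule.mem_sup_right hx)
        (Submodule.mem_sup_left (Submodule.subset_span hy))
  have hdisj : Submodule.span R M ⊓ L = ⊥ := by
    rw [Submodule.eq_bot_iff]
    rintro x ⟨hxM, hxL⟩
    obtain ⟨t, ht, htx⟩ := hM.exists_smul_of_mem_span hxM
    have : t • x ∈ (L : Set V) ∩ M := ⟨L.smul_mem t hxL, htx⟩
    rw [hinf, Set.mem_singleton_iff] at this
    exact (smul_eq_zero.1 this).resolve_left ht.ne'
  have := Submodule.finrank_sup_add_finrank_inf_eq (Submodule.span R M) L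
  rw [hsup, hdisj, finrank_bot, add_zero] at this
  exact this.symm

/-- All modular parts of an external point have the same dimension. -/
theorem IsModularPart.hasDim [Module.Finite R V] {ξ M M' : Set V} {L : Submodule R V}
    (hL : linearPart R ξ = L) (hM : IsModularPart R ξ M) (hM' : IsModularPart R ξ M') {d : ℕ}
    (hd : HasDim R M d) : HasDim R M' d := by
  obtain ⟨hMn, hMadd, hMinf⟩ := hM
  obtain ⟨hMn', hMadd', hMinf'⟩ := hM'
  rw [hL] at hMadd hMinf hMadd' hMinf'
  have h := finrank_span_add_finrank hMn hMadd hMinf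
  have h' := finrank_span_add_finrank hMn' hMadd' hMinf'
  rw [hd.unique (hasDim_finrank_span M),
    show Module.finrank R (Submodule.span R M) = Module.finrank R (Submodule.span R M') by omega]
  exact hasDim_finrank_span M'

end Dimension

/-! ### Dimensions of the two sums in the closed formula. -/

section ModularSum

variable {R : Type*} [Field R] [LinearOrder R] {n p : ℕ}
  {Q : Matrix (Fin p) (Fin n) R} {C : Fin p → ExternalNumber R}

theorem span_modularSum (Q : Matrix (Fin p) (Fin n) R) (C : Fin p → ExternalNumber R) :
    Submodule.span R (modularSum Q C) = Submodule.span R (Set.range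
      fun i : {i : Fin Q.rank | (leadingPart Q C i).neutrix ≠ {0}} =>
        supportMap Q (Pi.single i.1 1)) := by
  apply le_antisymm
  · rw [Submodule.span_le]
    intro y hy
    obtain ⟨u, hu, rfl⟩ := IsIncreasingRowEchelon.mem_modularSum.1 hy
    rw [pi_eq_sum_univ' u, map_sum]
    refine Submodule.sum_mem _ fun i _ => ?_
    rw [map_smul]
    by_cases hi : (leadingPart Q C i).neutrix = {0}
    · have := hu i
      rw [hi, Set.mem_singleton_iff] at this
      simp [this]
    · exact Submodule.smul_mem _ _ (Submodule.subset_span ⟨⟨i, hi⟩, rfl⟩)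
  · rw [Submodule.span_le]
    rintro _ ⟨⟨i, hi⟩, rfl⟩
    have h0 := (leadingPart Q C i).isNeutrix_neutrix.zero_mem
    -- A nonzero neutrix contains some t ≠ 0; dividing by it recovers the unit direction in the
    -- span.
    obtain ⟨t, ht, ht0⟩ : ∃ t ∈ (leadingPart Q C i).neutrix, t ≠ 0 := by
      by_contra! h
      exact hi (Set.eq_singleton_iff_unique_mem.2 ⟨h0, h⟩)
    have hmem : supportMap Q (Pi.single i t) ∈ modularSum Q C := by
      refine IsIncreasingRowEchelon.mem_modularSum.2 ⟨_, fun j => ?_, rfl⟩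
      rcases eq_or_ne j i with rfl | hj
      · rwa [Pi.single_eq_same]
      · rw [Pi.single_eq_of_ne hj]
        exact (leadingPart Q C j).isNeutrix_neutrix.zero_mem
    have := Submodule.smul_mem _ t⁻¹ (Submodule.subset_span (R := R) hmem)
    rwa [← map_smul, ← Pi.single_smul, smul_eq_mul, inv_mul_cancel₀ ht0] at this

namespace IsIncreasingRowEchelon

theorem finrank_span_modularSum (h : IsIncreasingRowEchelon Q C) :
    Module.finrank R (Submodule.span R (modularSum Q C)) = numNonzeroNeutrices Q C := by
  classical
  have hli : LinearIndependent R
      fun i : {i : Fin Q.rank | (leadingPart Q C i).neutrix ≠ {0}} =>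
        supportMap Q (Pi.single i.1 1) := by
    have hb := ((Pi.basisFun R (Fin Q.rank)).linearIndependent.map' (supportMap Q)
      (LinearMap.ker_eq_bot.2 h.supportMap_injective)).comp
      (Subtype.val : {i : Fin Q.rank | (leadingPart Q C i).neutrix ≠ {0}} → _)
      Subtype.val_injective
    simp only [Function.comp_def, Pi.basisFun_apply] at hb
    exact hb
  rw [span_modularSum, finrank_span_eq_card hli, numNonzeroNeutrices, Set.ncard_eq_toFinset_card',
    Set.toFinset_card]

theorem hasDim_modularSum (h : IsIncreasingRowEchelon Q C) :
    HasDim R (modularSum Q C) (numNonzeroNeutrices Q C) := by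
  rw [← h.finrank_span_modularSum]
  exact hasDim_finrank_span _

theorem linearSum_eq_ker (h : IsIncreasingRowEchelon Q C) :
    linearSum Q = (LinearMap.ker (leadingRows Q).mulVecLin : Set (Fin n → R)) := by
  ext y
  rw [h.mem_linearSum]
  rfl

theorem hasDim_linearSum (h : IsIncreasingRowEchelon Q C) :
    HasDim R (linearSum Q) (n - Q.rank) := by
  rw [h.linearSum_eq_ker, ← h.finrank_ker_leadingRows]
  exact hasDim_submodule _

end IsIncreasingRowEchelon

end ModularSum

/-! ### Undoing the column interchanges. -/

section Permutation

variable {R : Type*} [Field R] {n : ℕ}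

/-- Presents H⁻¹ as a linear equivalence, along which neutrix parts, linear parts and dimensions are
transported. -/
theorem permMatrix_inv_mulVec (σ : Equiv.Perm (Fin n)) (y : Fin n → R) :
    (σ.permMatrix R)⁻¹.mulVec y = LinearEquiv.funCongrLeft R R σ.symm y := by
  have h : σ.permMatrix R * (σ⁻¹).permMatrix R = 1 := by
    rw [← Matrix.permMatrix_mul, inv_mul_cancel, Matrix.permMatrix_one]
  rw [Matrix.inv_eq_right_inv h, Matrix.permMatrix_mulVec]
  rfl

theorem eq_image_funCongrLeft [LinearOrder R] {p q : ℕ} {σ : Equiv.Perm (Fin n)}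
    {A : Matrix (Fin q) (Fin n) (ExternalNumber R)}
    {B : Fin q → ExternalNumber R} {A' : Matrix (Fin p) (Fin n) (ExternalNumber R)}
    {B' : Fin p → ExternalNumber R} (h : HEquivalent (σ.permMatrix R) A B A' B') :
    solutionSet A B = LinearEquiv.funCongrLeft R R σ.symm '' solutionSet A' B' := by
  rw [hEquivalent_permMatrix_iff] at h
  have hinv : ∀ x : Fin n → R, LinearEquiv.funCongrLeft R R σ.symm (x ∘ σ) = x := fun x => by
    ext i; simp [LinearMap.funLeft]
  ext x
  rw [h x]
  constructor
  · exact fun hx => ⟨_, hx, hinv x⟩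
  · rintro ⟨y, hy, rfl⟩
    have : (LinearEquiv.funCongrLeft R R σ.symm y) ∘ σ = y := by
      ext i; simp [LinearMap.funLeft]
    rwa [this]

end Permutation

/-! ### Transfer to the original flexible system, and the theorem. -/

namespace IsAssociated

variable {R : Type*} [Field R] [LinearOrder R] {m n : ℕ}
  {A : Matrix (Fin m) (Fin n) (ExternalNumber R)} {B : Fin m → ExternalNumber R}
  {P : Matrix (Fin m) (Fin n) R} {σ : Equiv.Perm (Fin n)}
  {Q : Matrix (Fin (m + constraintDim A B)) (Fin n) R}
  {C : Fin (m + constraintDim A B) → ExternalNumber R}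

theorem rank_eq (h : IsAssociated A B P σ Q C) : Q.rank = (integratedMatrix A B P).rank :=
  h.2.1.rank_eq

theorem hEquivalent (h : IsAssociated A B P σ Q C) (hP : IsRepresentative A P) :
    HEquivalent (σ.permMatrix R) A B (toExternal Q) C := by
  rw [hEquivalent_permMatrix_iff, solutionSet_eq_integrated hP, ← hEquivalent_permMatrix_iff]
  exact h.2.2

theorem solutionSet_eq (h : IsAssociated A B P σ Q C) (hP : IsRepresentative A P) :
    solutionSet A B =
      LinearEquiv.funCongrLeft R R σ.symm '' solutionSet (toExternal Q) C :=
  eq_image_funCongrLeft (h.hEquivalent hP)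

theorem nonempty_iff (h : IsAssociated A B P σ Q C) (hP : IsRepresentative A P) :
    (solutionSet A B).Nonempty ↔
      ∀ i : Fin (m + constraintDim A B), Q.rank ≤ i.val → (C i).IsNeutricial := by
  rw [h.solutionSet_eq hP, Set.image_nonempty, h.1.solutionSet_nonempty_iff]

variable [IsStrictOrderedRing R]

theorem exists_of_one_le_rank (h : 1 ≤ (integratedMatrix A B P).rank) :
    ∃ σ Q C, IsAssociated A B P σ Q C := by
  obtain ⟨σ, Q, C, hE, hQ⟩ := exists_equivElim_isIncreasingRowEchelon _ (integratedRHS A B) h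
  exact ⟨σ, Q, C, hQ, hE.1, hE.2⟩

theorem neutrix_ne_univ (h : IsAssociated A B P σ Q C) (hB : ∀ i, (B i).neutrix ≠ Set.univ) :
    ∀ i, (C i).neutrix ≠ Set.univ :=
  h.2.1.neutrix_ne_univ (integratedRHS_neutrix_ne_univ hB)

theorem neutrixPart_eq (h : IsAssociated A B P σ Q C) (hP : IsRepresentative A P)
    (hne : (solutionSet A B).Nonempty) :
    neutrixPart (solutionSet A B) =
      LinearEquiv.funCongrLeft R R σ.symm '' (modularSum Q C + linearSum Q) := by
  rw [h.solutionSet_eq hP, LinearEquiv.neutrixPart_image,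
    h.1.neutrixPart_solutionSet ((h.nonempty_iff hP).1 hne)]

theorem linearPart_eq (h : IsAssociated A B P σ Q C) (hB : ∀ i, (B i).neutrix ≠ Set.univ)
    (hP : IsRepresentative A P) (hne : (solutionSet A B).Nonempty) :
    linearPart R (solutionSet A B) = LinearEquiv.funCongrLeft R R σ.symm '' linearSum Q := by
  rw [h.solutionSet_eq hP, LinearEquiv.linearPart_image,
    h.1.linearPart_solutionSet ((h.nonempty_iff hP).1 hne) (h.neutrix_ne_univ hB)]

theorem isModularPart_image (h : IsAssociated A B P σ Q C) (hB : ∀ i, (B i).neutrix ≠ Set.univ)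
    (hP : IsRepresentative A P) (hne : (solutionSet A B).Nonempty) :
    IsModularPart R (solutionSet A B)
      (LinearEquiv.funCongrLeft R R σ.symm '' modularSum Q C) := by
  rw [h.solutionSet_eq hP]
  exact LinearEquiv.isModularPart_image _
    (h.1.isModularPart_modularSum ((h.nonempty_iff hP).1 hne) (h.neutrix_ne_univ hB))

theorem hasDim_of_isModularPart (h : IsAssociated A B P σ Q C)
    (hB : ∀ i, (B i).neutrix ≠ Set.univ) (hP : IsRepresentative A P)
    (hne : (solutionSet A B).Nonempty) {M : Set (Fin n → R)}
    (hM : IsModularPart R (solutionSet A B) M) : HasDim R M (numNonzeroNeutrices Q C) := by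
  refine IsModularPart.hasDim (L := (LinearMap.ker (leadingRows Q).mulVecLin).map
    (LinearEquiv.funCongrLeft R R σ.symm).toLinearMap) ?_ (h.isModularPart_image hB hP hne) hM
    (h.1.hasDim_modularSum.image _)
  rw [h.linearPart_eq hB hP hne, h.1.linearSum_eq_ker]
  rfl

end IsAssociated

theorem theorem3p1 {R : Type*} [Field R] [LinearOrder R] [IsStrictOrderedRing R] {m n : ℕ}
    (A : Matrix (Fin m) (Fin n) (ExternalNumber R)) (B : Fin m → ExternalNumber R)
    (hB : ∀ i, (B i).neutrix ≠ Set.univ)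
    (P : Matrix (Fin m) (Fin n) R) (hP : IsRepresentative A P)
    (r : ℕ) (hr : (integratedMatrix A B P).rank = r) (hr1 : 1 ≤ r) :
    -- existence of an associated system in increasing row-echelon form
    (∃ σ Q C, IsAssociated A B P σ Q C) ∧
    -- properties of any associated system
    (∀ σ Q C, IsAssociated A B P σ Q C →
      HEquivalent (σ.permMatrix R) A B (toExternal Q) C ∧
      Q.rank = r ∧
      -- consistency
      ((solutionSet (toExternal Q) C).Nonempty ↔ ∀ i, r ≤ i.val → (C i).IsNeutricial) ∧
      ((solutionSet A B).Nonempty ↔ ∀ i, r ≤ i.val → (C i).IsNeutricial) ∧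
      ((solutionSet A B).Nonempty →
        -- exactness
        solutionSet (toExternal Q) C =
          solutionSet (toExternal (leadingRows Q)) (leadingPart Q C) ∧
        IsExact (toExternal (leadingRows Q)) (leadingPart Q C) ∧
        (IsExact (toExternal Q) C ↔ ∀ i, r ≤ i.val → (C i).carrier = {0}) ∧
        -- the closed form of the solution
        IsExternalPoint R (solutionSet (toExternal Q) C) ∧
        (∀ c : Fin (m + constraintDim A B) → R, (∀ i, c i ∈ (C i).carrier) →
          solutionSet (toExternal Q) C = {supportVector Q c} + modularSum Q C + linearSum Q) ∧
        IsUnit (leadingBlock Q).det ∧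
        (leadingBlock Q)⁻¹.BlockTriangular id ∧
        solutionSet A B =
          (fun y => (σ.permMatrix R)⁻¹.mulVec y) '' solutionSet (toExternal Q) C ∧
        -- the linear part
        linearPart R (solutionSet (toExternal Q) C) = linearSum Q ∧
        r ≤ n ∧ HasDim R (linearPart R (solutionSet (toExternal Q) C)) (n - r) ∧
        -- the modular part
        IsModularPart R (solutionSet (toExternal Q) C) (modularSum Q C) ∧
        HasDim R (modularSum Q C) (numNonzeroNeutrices Q C) ∧
        (∀ M, IsModularPart R (solutionSet A B) M → HasDim R M (numNonzeroNeutrices Q C)))) ∧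
    -- independence of the representative matrix
    (∀ P', IsRepresentative A P' →
      (integratedMatrix A B P').rank = r ∧
      ∀ σ Q C σ' Q' C', IsAssociated A B P σ Q C → IsAssociated A B P' σ' Q' C' →
        Q'.rank = Q.rank ∧
        ((solutionSet A B).Nonempty →
          neutrixPart ((fun y => (σ'.permMatrix R)⁻¹.mulVec y) '' solutionSet (toExternal Q') C') =
            neutrixPart ((fun y => (σ.permMatrix R)⁻¹.mulVec y) '' solutionSet (toExternal Q) C) ∧
          linearPart R
              ((fun y => (σ'.permMatrix R)⁻¹.mulVec y) '' solutionSet (toExternal Q') C') =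
            linearPart R
              ((fun y => (σ.permMatrix R)⁻¹.mulVec y) '' solutionSet (toExternal Q) C) ∧
          (fun y => (σ'.permMatrix R)⁻¹.mulVec y) '' (modularSum Q' C' + linearSum Q') =
            (fun y => (σ.permMatrix R)⁻¹.mulVec y) '' (modularSum Q C + linearSum Q) ∧
          (fun y => (σ'.permMatrix R)⁻¹.mulVec y) '' linearSum Q' =
            (fun y => (σ.permMatrix R)⁻¹.mulVec y) '' linearSum Q ∧
          numNonzeroNeutrices Q' C' = numNonzeroNeutrices Q C)) := by
  refine ⟨IsAssociated.exists_of_one_le_rank (hr.symm ▸ hr1), fun σ Q C h => ?_,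
    fun P' hP' => ⟨(integratedMatrix_rank_eq hB hP hP').symm.trans hr,
      fun σ Q C σ' Q' C' h h' => ⟨?_, fun hne => ?_⟩⟩⟩
  · have hQr : Q.rank = r := h.rank_eq.trans hr
    subst hQr
    refine ⟨h.hEquivalent hP, rfl, h.1.solutionSet_nonempty_iff, h.nonempty_iff hP,
      fun hne => ?_⟩
    have hC := (h.nonempty_iff hP).1 hne
    have hU := h.neutrix_ne_univ hB
    have hlin := h.1.linearPart_solutionSet hC hU
    simp only [permMatrix_inv_mulVec]
    exact ⟨h.1.solutionSet_eq_leadingRows hC, h.1.isExact_leadingRows, h.1.isExact_iff,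
      h.1.isExternalPoint_solutionSet hC,
      fun c hc => (h.1.solutionSet_eq hC hc).trans (add_assoc _ _ _).symm,
      h.1.isUnit_det_leadingBlock, h.1.leadingBlock_inv_blockTriangular, h.solutionSet_eq hP,
      hlin, Q.rank_le_width, hlin ▸ h.1.hasDim_linearSum, h.1.isModularPart_modularSum hC hU,
      h.1.hasDim_modularSum, fun M hM => h.hasDim_of_isModularPart hB hP hne hM⟩
  · rw [h.rank_eq, h'.rank_eq, integratedMatrix_rank_eq hB hP hP']
  · simp only [permMatrix_inv_mulVec]
    -- Each image under H⁻¹ is rewritten as ξ, its neutrix part or its linear part, none of which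
    -- involves `P`.
    rw [← h.solutionSet_eq hP, ← h'.solutionSet_eq hP', ← h.neutrixPart_eq hP hne,
      ← h'.neutrixPart_eq hP' hne, ← h.linearPart_eq hB hP hne, ← h'.linearPart_eq hB hP' hne]
    -- One modular part of ξ has both numbers as its dimension, so they agree.
    exact ⟨rfl, rfl, rfl, rfl, (h'.hasDim_of_isModularPart hB hP' hne
      (h.isModularPart_image hB hP hne)).unique (h.hasDim_of_isModularPart hB hP hne
      (h.isModularPart_image hB hP hne))⟩
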